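/- Let $H$ be a complex Hilbert space and let $A\subseteq B(H)$ be an operator algebra, i.e. a norm closed subalgebra containing a contractive approximate identity. An operator space is a Banach space $E$ with norms on all $M_n(E)$, extending that of $E=M_1(E)$ and satisfying Ruan's axioms. Let $\mathrm{OMOD}_A$ be the category whose objects are the non-degenerate right operator $A$-modules, i.e. the operator spaces $E$ with a right $A$-module structure such that the induced map $E\otimes_h A\to E$ on the Haagerup tensor product is completely contractive and the linear span of $\{x\cdot a : x\in E,\ a\in A\}$ is dense in $E$, and whose morphisms are the completely bounded $A$-module maps. A kernel–cokernel pair is a pair of composable morphisms $(\mu,\pi)$ such that $\mu$ is a kernel of $\pi$ and $\pi$ is a cokernel of $\mu$. An exact structure on an additive category is an isomorphism-closed class of kernel–cokernel pairs, whose first (second) components are called admissible monomorphisms (epimorphisms), such that: identities are admissible monomorphisms and admissible epimorphisms; admissible monomorphisms and admissible epimorphisms are each closed under composition; pushouts of admissible monomorphisms along arbitrary morphisms exist and are admissible monomorphisms; pullbacks of admissible epimorphisms along arbitrary morphisms exist and are admissible epimorphisms. Then: 1. $\mathrm{OMOD}_A$ is additive, and the class of all kernel–cokernel pairs is an exact structure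 on $\mathrm{OMOD}_A$. 2. $\mathrm{OMOD}_A$ is quasi-abelian: it is additive, every morphism has a kernel and a cokernel, and the class of all kernel–cokernel pairs satisfies the above pushout and pullback conditions. 3. A morphism $f:E\to F$ is a kernel of some morphism if and only if $f(E)$ is closed in $F$ and $f$, viewed as a map onto $f(E)$, is a bijective completely bounded $A$-module map with completely bounded inverse. 4. A morphism $f:E\to F$ is a cokernel of some morphism if and only if it is completely open, i.e. there is $\gamma>0$ such that for every $n$ each $y\in M_n(F)$ with $\|y\|_n<\gamma$ equals $f_n(x)$ for some $x\in M_n(E)$ with $\|x\|_n<1$, where $f_n$ denotes entrywise application of $f$. 5. All pullbacks exist in $\mathrm{OMOD}_A$, and in every pullback square with $f:E\to G$, $g:F\to G$ and projections $p:L\to E$, $q:L\to F$, if $f$ is a cokernel of some morphism, then so is $q$. 6. All pushouts exist in $\mathrm{OMOD}_A$, and in every pushout square with $f:G\to E$, $g:G\to F$ and $p:E\to L$, $q:F\to L$, if $f$ is a kernel of some morphism, then so is $q$. -/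

import Mathlib

open CategoryTheory CategoryTheory.Limits
open scoped TensorProduct ENNReal

universe u v w

/-! ## Exact and quasi-abelian categories -/

namespace ExactCat

variable {C : Type u} [Category.{v} C] [Preadditive C]

/-- A preadditive category is additive if it has a zero object and a product of any two
objects. -/
structure IsAdditive (C : Type u) [Category.{v} C] [Preadditive C] : Prop where
  hasZeroObject : HasZeroObject C
  hasBinaryProducts : HasBinaryProducts C

/-- `f` is a kernel of some morphism. -/
def IsKernelMap {X Y : C} (f : X ⟶ Y) : Prop :=
  ∃ (Z : C) (g : Y ⟶ Z) (w : f ≫ g = 0), Nonempty (IsLimit (KernelFork.ofι f w))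

/-- `g` is a cokernel of some morphism. -/
def IsCokernelMap {Y Z : C} (g : Y ⟶ Z) : Prop :=
  ∃ (X : C) (f : X ⟶ Y) (w : f ≫ g = 0), Nonempty (IsColimit (CokernelCofork.ofπ g w))

/-- A kernel-cokernel pair `X ⟶ Y ⟶ Z`: the first morphism is a kernel of the second one, and the
second one is a cokernel of the first one. This is also the class of all kernel-cokernel pairs,
as a class of composable pairs of morphisms with zero composite. -/
def KernelCokernelPair (S : ShortComplex C) : Prop :=
  Nonempty (IsLimit (KernelFork.ofι S.f S.zero)) ∧
    Nonempty (IsColimit (CokernelCofork.ofπ S.g S.zero))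

/-- `f` is the first morphism of a pair in the class `𝓔`. -/
def AdmissibleMono (𝓔 : ShortComplex C → Prop) {X Y : C} (f : X ⟶ Y) : Prop :=
  ∃ (Z : C) (g : Y ⟶ Z) (w : f ≫ g = 0), 𝓔 (ShortComplex.mk f g w)

/-- `g` is the second morphism of a pair in the class `𝓔`. -/
def AdmissibleEpi (𝓔 : ShortComplex C → Prop) {Y Z : C} (g : Y ⟶ Z) : Prop :=
  ∃ (X : C) (f : X ⟶ Y) (w : f ≫ g = 0), 𝓔 (ShortComplex.mk f g w)

/-- The pushout of an admissible monomorphism along an arbitrary morphism exists and yields an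
admissible monomorphism. -/
def AxiomE2 (𝓔 : ShortComplex C → Prop) : Prop :=
  ∀ {X Y Z : C} (f : X ⟶ Y) (g : X ⟶ Z), AdmissibleMono 𝓔 f →
    HasPushout f g ∧
      ∀ {P : C} (h : Y ⟶ P) (k : Z ⟶ P), IsPushout f g h k → AdmissibleMono 𝓔 k

/-- The pullback of an admissible epimorphism along an arbitrary morphism exists and yields an
admissible epimorphism. -/
def AxiomE2op (𝓔 : ShortComplex C → Prop) : Prop :=
  ∀ {X Y Z : C} (f : X ⟶ Z) (g : Y ⟶ Z), AdmissibleEpi 𝓔 f →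
    HasPullback f g ∧
      ∀ {P : C} (h : P ⟶ X) (k : P ⟶ Y), IsPullback h k f g → AdmissibleEpi 𝓔 k

/-- A (Quillen) exact structure: an isomorphism-closed class of kernel-cokernel pairs
satisfying the axioms E0, E1, E2 and their duals. -/
structure IsExactStructure (𝓔 : ShortComplex C → Prop) : Prop where
  kernelCokernelPair : ∀ S : ShortComplex C, 𝓔 S → KernelCokernelPair S
  of_iso : ∀ S T : ShortComplex C, Nonempty (S ≅ T) → 𝓔 S → 𝓔 T
  e0 : ∀ X : C, AdmissibleMono 𝓔 (𝟙 X)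
  e0op : ∀ X : C, AdmissibleEpi 𝓔 (𝟙 X)
  e1 : ∀ {X Y Z : C} (f : X ⟶ Y) (g : Y ⟶ Z),
    AdmissibleMono 𝓔 f → AdmissibleMono 𝓔 g → AdmissibleMono 𝓔 (f ≫ g)
  e1op : ∀ {X Y Z : C} (f : X ⟶ Y) (g : Y ⟶ Z),
    AdmissibleEpi 𝓔 f → AdmissibleEpi 𝓔 g → AdmissibleEpi 𝓔 (f ≫ g)
  e2 : AxiomE2 𝓔
  e2op : AxiomE2op 𝓔

/-- A quasi-abelian category: an additive category with all kernels and cokernels in which the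
class of all kernel-cokernel pairs satisfies E2 and its dual. -/
structure IsQuasiAbelian (C : Type u) [Category.{v} C] [Preadditive C] : Prop where
  isAdditive : IsAdditive C
  hasKernels : HasKernels C
  hasCokernels : HasCokernels C
  e2 : AxiomE2 (KernelCokernelPair (C := C))
  e2op : AxiomE2op (KernelCokernelPair (C := C))

end ExactCat

/-! ## Operator spaces, operator algebras and the Haagerup tensor norm -/

namespace OpMod

/-- The product `α x β` of a matrix `x` with entries in `E` and scalar matrices `α`, `β`. -/
def scalarMul {E : Type u} [AddCommGroup E] [Module ℂ E] {m n : ℕ}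
    (α : Matrix (Fin n) (Fin m) ℂ) (x : Matrix (Fin m) (Fin m) E)
    (β : Matrix (Fin m) (Fin n) ℂ) : Matrix (Fin n) (Fin n) E :=
  fun i j => ∑ k, ∑ l, (α i k * β l j) • x k l

/-- The block matrix with rows `[x, y]` and `[z, t]`, indexed by `Fin (m + n)`. -/
def blocks {E : Type u} {m n : ℕ} (x : Matrix (Fin m) (Fin m) E) (y : Matrix (Fin m) (Fin n) E)
    (z : Matrix (Fin n) (Fin m) E) (t : Matrix (Fin n) (Fin n) E) :
    Matrix (Fin (m + n)) (Fin (m + n)) E :=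
  Matrix.reindex finSumFinEquiv finSumFinEquiv (Matrix.fromBlocks x y z t)

open scoped Matrix.Norms.L2Operator in
/-- A (complete) operator space: a Banach space with norms on all spaces `M_n(E)` satisfying
Ruan's axioms, the norm on `M_1(E)` being the given norm of `E`. In `matNorm_scalarMul`, the norms
of the scalar matrices are their operator norms between Euclidean spaces. (It follows that each
`matNorm n` is definite, since it dominates the norms of the entries, and complete.) -/
class OperatorSpace (E : Type u) [NormedAddCommGroup E] [NormedSpace ℂ E] extends
    CompleteSpace E where
  matNorm : ∀ n : ℕ, Seminorm ℂ (Matrix (Fin n) (Fin n) E)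
  matNorm_one : ∀ x : Matrix (Fin 1) (Fin 1) E, matNorm 1 x = ‖x 0 0‖
  matNorm_blocks : ∀ {m n : ℕ} (x : Matrix (Fin m) (Fin m) E) (y : Matrix (Fin n) (Fin n) E),
    matNorm (m + n) (blocks x 0 0 y) = max (matNorm m x) (matNorm n y)
  matNorm_scalarMul : ∀ {m n : ℕ} (α : Matrix (Fin n) (Fin m) ℂ) (x : Matrix (Fin m) (Fin m) E)
    (β : Matrix (Fin m) (Fin n) ℂ), matNorm n (scalarMul α x β) ≤ ‖α‖ * matNorm m x * ‖β‖

/-- The norm of a rectangular matrix over an operator space, as the norm of the square matrix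
obtained by adding zero blocks. -/
noncomputable def rectNorm {E : Type u} [NormedAddCommGroup E] [NormedSpace ℂ E] [OperatorSpace E] {n p : ℕ}
    (x : Matrix (Fin n) (Fin p) E) : ℝ :=
  OperatorSpace.matNorm (n + p) (blocks 0 x 0 0)

section OperatorAlgebra

variable {H : Type v} [NormedAddCommGroup H] [InnerProductSpace ℂ H]

/-- The operator `H ^ n → H ^ m` between Hilbert space direct sums given by a matrix of bounded
operators on `H`. -/
noncomputable def matrixOp {m n : ℕ} (a : Matrix (Fin m) (Fin n) (H →L[ℂ] H)) :
    PiLp 2 (fun _ : Fin n => H) →L[ℂ] PiLp 2 (fun _ : Fin m => H) :=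
  ((PiLp.continuousLinearEquiv 2 ℂ (fun _ : Fin m => H)).symm : _ →L[ℂ] _) ∘L
    ContinuousLinearMap.pi fun i => ∑ j, a i j ∘L PiLp.proj 2 (fun _ : Fin n => H) j

/-- The norm of an `m × n` matrix over a subalgebra of `B(H)`, as an operator `H ^ n → H ^ m`. -/
noncomputable def opNorm {A : NonUnitalSubalgebra ℂ (H →L[ℂ] H)} {m n : ℕ}
    (a : Matrix (Fin m) (Fin n) A) : ℝ :=
  ‖matrixOp (a.map fun b => (b : H →L[ℂ] H))‖

/-- `A` is an operator algebra: a norm closed subalgebra of `B(H)` containing a contractive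
approximate identity (a net, here a filter, in the unit ball of `A`). -/
structure IsOperatorAlgebra (A : NonUnitalSubalgebra ℂ (H →L[ℂ] H)) : Prop where
  isClosed : IsClosed (A : Set (H →L[ℂ] H))
  exists_approximateUnit :
    ∃ l : Filter A, l.IsApproximateUnit ∧ ∀ᶠ e : A in l, ‖(e : H →L[ℂ] H)‖ ≤ 1

variable {E : Type u} [NormedAddCommGroup E] [NormedSpace ℂ E] [OperatorSpace E]
variable {A : NonUnitalSubalgebra ℂ (H →L[ℂ] H)}

/-- The matrix `x ⊙ a` over `E ⊗ A` with entries `∑ k, x i k ⊗ a k j`. -/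
def odot {n p : ℕ} (x : Matrix (Fin n) (Fin p) E) (a : Matrix (Fin p) (Fin n) A) :
    Matrix (Fin n) (Fin n) (E ⊗[ℂ] A) :=
  fun i j => ∑ k, x i k ⊗ₜ[ℂ] a k j

/-- Every matrix over `E ⊗ A` has a factorization as in the definition of the Haagerup norm. -/
theorem exists_eq_odot {n : ℕ} (t : Matrix (Fin n) (Fin n) (E ⊗[ℂ] A)) :
    ∃ (p : ℕ) (x : Matrix (Fin n) (Fin p) E) (a : Matrix (Fin p) (Fin n) A),
      t = odot x a := by
  classical
  have h := fun i j => TensorProduct.exists_finset (t i j)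
  choose S hS using h
  let ι := Σ ij : Fin n × Fin n, S ij.1 ij.2
  let e := Fintype.equivFin ι
  refine ⟨Fintype.card ι, fun i k => if (e.symm k).1.1 = i then (e.symm k).2.1.1 else 0,
    fun k j => if (e.symm k).1.2 = j then (e.symm k).2.1.2 else 0, ?_⟩
  ext i j
  rw [hS i j]
  refine Eq.trans ?_ (e.symm.sum_comp fun s : ι =>
    (if s.1.1 = i then s.2.1.1 else 0) ⊗ₜ[ℂ] (if s.1.2 = j then s.2.1.2 else 0)).symm
  rw [Fintype.sum_sigma, Finset.sum_eq_single (i, j)]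
  · simp only [if_true]
    exact (Finset.sum_coe_sort (S i j) (fun s => s.1 ⊗ₜ[ℂ] s.2)).symm
  · rintro ⟨i', j'⟩ - hne
    apply Finset.sum_eq_zero
    intro s _
    dsimp only
    split_ifs with h1 h2
    · exact absurd (Prod.ext h1 h2) hne
    all_goals simp
  · simp

/-- The Haagerup tensor norm on `M_n(E ⊗ A)`: the infimum of `‖x‖ ‖a‖` over all factorizations
`t = x ⊙ a` with `x ∈ M_{n,p}(E)`, `a ∈ M_{p,n}(A)`. -/
noncomputable def haagerupNorm {n : ℕ} (t : Matrix (Fin n) (Fin n) (E ⊗[ℂ] A)) : ℝ :=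
  sInf {r | ∃ (p : ℕ) (x : Matrix (Fin n) (Fin p) E) (a : Matrix (Fin p) (Fin n) A),
    t = odot x a ∧ r = rectNorm x * opNorm a}

end OperatorAlgebra

end OpMod

/-! ## The category of operator modules -/

open OpMod

/-- A non-degenerate right operator `A`-module: a complete operator space `E` with a (bilinear,
associative) right action of `A` such that the induced map from the Haagerup tensor product of `E`
and `A` to `E` is completely contractive and the span of the elements `x · a` is dense in `E`.
(A completely contractive map on the algebraic tensor product with the Haagerup norms is the
same as one on its completion.) -/
structure OMod {H : Type v} [NormedAddCommGroup H] [InnerProductSpace ℂ H]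
    (A : NonUnitalSubalgebra ℂ (H →L[ℂ] H)) where
  carrier : Type u
  [normedAddCommGroup : NormedAddCommGroup carrier]
  [normedSpace : NormedSpace ℂ carrier]
  [operatorSpace : OperatorSpace carrier]
  act : carrier →ₗ[ℂ] A →ₗ[ℂ] carrier
  act_mul : ∀ (x : carrier) (a b : A), act x (a * b) = act (act x a) b
  act_completelyContractive : ∀ (n : ℕ) (t : Matrix (Fin n) (Fin n) (carrier ⊗[ℂ] A)),
    OperatorSpace.matNorm n (t.map (TensorProduct.lift act)) ≤ haagerupNorm t
  nondegenerate : Dense (Submodule.span ℂ {z : carrier | ∃ x a, z = act x a} : Set carrier)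

namespace OMod

variable {H : Type v} [NormedAddCommGroup H] [InnerProductSpace ℂ H]
variable {A : NonUnitalSubalgebra ℂ (H →L[ℂ] H)}

instance : CoeSort (OMod.{u} A) (Type u) := ⟨OMod.carrier⟩

instance (E : OMod.{u} A) : NormedAddCommGroup E := E.normedAddCommGroup
instance (E : OMod.{u} A) : NormedSpace ℂ E := E.normedSpace
instance (E : OMod.{u} A) : OperatorSpace E := E.operatorSpace

/-- The norm of `M_n(E)`. -/
noncomputable def mnorm {E : OMod.{u} A} {n : ℕ} (x : Matrix (Fin n) (Fin n) E) : ℝ :=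
  OperatorSpace.matNorm n x

/-- The group `CB_A(E, F)` of completely bounded `A`-module maps from `E` to `F`. -/
def CB (E F : OMod.{u} A) : AddSubgroup (E →ₗ[ℂ] F) where
  carrier := {f | (∀ x a, f (E.act x a) = F.act (f x) a) ∧
    ∃ c : ℝ, ∀ (n : ℕ) (x : Matrix (Fin n) (Fin n) E), mnorm (x.map f) ≤ c * mnorm x}
  zero_mem' := by
    refine ⟨fun x a => by simp, 0, fun n x => ?_⟩
    have h : x.map (0 : E →ₗ[ℂ] F) = 0 := by ext; simp
    simp [h, mnorm]
  add_mem' := by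
    rintro f g ⟨hf, c, hc⟩ ⟨hg, d, hd⟩
    refine ⟨fun x a => by simp [hf, hg], c + d, fun n x => ?_⟩
    have h : x.map (f + g : E →ₗ[ℂ] F) = x.map f + x.map g := by ext; simp
    rw [h, add_mul]
    exact (map_add_le_add _ _ _).trans (add_le_add (hc n x) (hd n x))
  neg_mem' := by
    rintro f ⟨hf, c, hc⟩
    refine ⟨fun x a => by simp [hf], c, fun n x => ?_⟩
    have h : x.map (-f : E →ₗ[ℂ] F) = -x.map f := by ext; simp
    rw [h]
    exact (map_neg_eq_map (OperatorSpace.matNorm n) (x.map f)).trans_le (hc n x)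

/-- Objects: non-degenerate right operator `A`-modules. Morphisms: completely bounded `A`-module
maps. -/
instance : Category (OMod.{u} A) where
  Hom E F := CB E F
  id E := ⟨LinearMap.id, fun _ _ => rfl, 1, fun n x => by simp⟩
  comp f g := ⟨g.1 ∘ₗ f.1, fun x a => by simp [f.2.1, g.2.1], by
    obtain ⟨c, hc⟩ := f.2.2
    obtain ⟨d, hd⟩ := g.2.2
    refine ⟨max d 0 * c, fun n x => ?_⟩
    have h : x.map (g.1 ∘ₗ f.1) = (x.map f.1).map g.1 := by ext; simp
    rw [h, mul_assoc]
    refine (hd n _).trans ?_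
    refine (mul_le_mul_of_nonneg_right (le_max_left d 0) (apply_nonneg _ _)).trans ?_
    exact mul_le_mul_of_nonneg_left (hc n x) (le_max_right d 0)⟩

/-- The linear map underlying a morphism. -/
def lin {E F : OMod.{u} A} (f : E ⟶ F) : E →ₗ[ℂ] F := f.1

instance : Preadditive (OMod.{u} A) where
  homGroup E F := inferInstanceAs (AddCommGroup (CB E F))
  add_comp _ _ _ f f' g := Subtype.ext (LinearMap.comp_add f.1 f'.1 g.1)
  comp_add _ _ _ f g g' := Subtype.ext (LinearMap.add_comp f.1 g'.1 g.1)

/-- `f` has closed range and is, as a map onto its range (with the matrix norms and the module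
action of `F`), a bijective completely bounded `A`-module map with completely bounded inverse
`g`. -/
def IsCBIsoOntoClosedRange {E F : OMod.{u} A} (f : E ⟶ F) : Prop :=
  IsClosed (LinearMap.range (lin f) : Set F) ∧
    ∃ g : LinearMap.range (lin f) →ₗ[ℂ] E,
      (∀ x, g ((lin f).rangeRestrict x) = x) ∧
      (∀ y, (lin f).rangeRestrict (g y) = y) ∧
      (∀ (y z : LinearMap.range (lin f)) (a : A),
        (z : F) = F.act y a → g z = E.act (g y) a) ∧
      ∃ c : ℝ, ∀ (n : ℕ) (y : Matrix (Fin n) (Fin n) (LinearMap.range (lin f))),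
        mnorm (y.map g) ≤ c * mnorm (y.map fun z => (z : F))

/-- `f` is completely open: for some `γ > 0` and all `n`, the amplification of `f` maps the open
unit ball of `M_n(E)` onto a set containing the open `γ`-ball of `M_n(F)`. -/
def IsCompletelyOpen {E F : OMod.{u} A} (f : E ⟶ F) : Prop :=
  ∃ γ : ℝ, 0 < γ ∧ ∀ (n : ℕ) (y : Matrix (Fin n) (Fin n) F), mnorm y < γ →
    ∃ x : Matrix (Fin n) (Fin n) E, mnorm x < 1 ∧ x.map (lin f) = y

end OMod

/-!
Both kinds of admissible morphisms are characterised by an estimate that is uniform over all matrix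
levels. A kernel is, up to complete isomorphism, the inclusion of a closed submodule, so kernels are
the morphisms with `‖x‖ ≤ c ‖fₙ x‖`; a cokernel is, up to complete isomorphism, the quotient by a
closed submodule, so cokernels are the morphisms for which every `y` equals `fₙ x` for some `x` with
`‖x‖ ≤ c ‖y‖`. Closed submodules of a non-degenerate module are again non-degenerate because
`x · e_i → x` along the approximate identity, for every `x` in the module.

Both estimates can be checked on the usual models of pullbacks and pushouts. In the pullback of `f`
and `g` one lifts `y` by solving `fₙ x = gₙ y` with control of `‖x‖`. In the pushout
`(E ⊕ F) / {(f w, - g w)}` of a kernel `f` the submodule is already closed, and any representative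
`(f w, y - g w)` of the class of `(0, y)` controls `w` through `f`, hence also `y`. That admissible
morphisms compose is then a formal consequence in every quasi-abelian category.
-/

open scoped NNReal

namespace ExactCat

variable {C : Type u} [Category.{v} C] [Preadditive C]

theorem KernelCokernelPair.of_iso {S T : ShortComplex C} (e : S ≅ T)
    (h : KernelCokernelPair S) : KernelCokernelPair T := by
  obtain ⟨⟨hf⟩, ⟨hg⟩⟩ := h
  exact ⟨⟨IsKernel.ofIso _ hf _ (ShortComplex.π₂.mapIso e) (ShortComplex.π₃.mapIso e)
      (ShortComplex.π₁.mapIso e) e.hom.comm₂₃ e.hom.comm₁₂⟩,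
    ⟨IsCokernel.ofIso _ hg _ (ShortComplex.π₁.mapIso e) (ShortComplex.π₂.mapIso e)
      (ShortComplex.π₃.mapIso e) e.hom.comm₁₂ e.hom.comm₂₃⟩⟩

theorem isKernelMap_id (X : C) : IsKernelMap (𝟙 X) :=
  ⟨X, 0, comp_zero, ⟨KernelFork.IsLimit.ofId _ rfl⟩⟩

theorem isCokernelMap_id (X : C) : IsCokernelMap (𝟙 X) :=
  ⟨X, 0, zero_comp, ⟨CokernelCofork.IsColimit.ofId _ rfl⟩⟩

theorem IsKernelMap.mono {X Y : C} {f : X ⟶ Y} (hf : IsKernelMap f) : Mono f := by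
  obtain ⟨_, _, _, ⟨h⟩⟩ := hf
  exact mono_of_isLimit_fork h

theorem IsCokernelMap.epi {X Y : C} {f : X ⟶ Y} (hf : IsCokernelMap f) : Epi f := by
  obtain ⟨_, _, _, ⟨h⟩⟩ := hf
  exact epi_of_isColimit_cofork h

theorem admissibleMono_iff_isKernelMap [HasCokernels C] {X Y : C} {f : X ⟶ Y} :
    AdmissibleMono KernelCokernelPair f ↔ IsKernelMap f := by
  refine ⟨fun ⟨Z, g, w, h⟩ => ⟨Z, g, w, h.1⟩, fun ⟨Z, g, w, ⟨h⟩⟩ => ?_⟩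
  refine ⟨cokernel f, cokernel.π f, cokernel.condition f, ⟨?_⟩, ⟨cokernelIsCokernel f⟩⟩
  refine KernelFork.isLimitOfIsLimitOfIff' h _ fun _ φ => ⟨fun hφ => ?_, fun hφ => ?_⟩
  · obtain ⟨l, hl⟩ := KernelFork.IsLimit.lift' h φ hφ
    rw [← hl, Fork.ι_ofι, Category.assoc, cokernel.condition, comp_zero]
  · rw [← cokernel.π_desc f g w, reassoc_of% hφ, zero_comp]

theorem admissibleEpi_iff_isCokernelMap [HasKernels C] {X Y : C} {g : X ⟶ Y} :
    AdmissibleEpi KernelCokernelPair g ↔ IsCokernelMap g := by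
  refine ⟨fun ⟨Z, f, w, h⟩ => ⟨Z, f, w, h.2⟩, fun ⟨Z, f, w, ⟨h⟩⟩ => ?_⟩
  refine ⟨kernel g, kernel.ι g, kernel.condition g, ⟨kernelIsKernel g⟩, ⟨?_⟩⟩
  refine CokernelCofork.isColimitOfIsColimitOfIff' h _ fun _ φ => ⟨fun hφ => ?_, fun hφ => ?_⟩
  · obtain ⟨l, hl⟩ := CokernelCofork.IsColimit.desc' h φ hφ
    rw [← hl, Cofork.π_ofπ, kernel.condition_assoc, zero_comp]
  · rw [← kernel.lift_ι g f w, Category.assoc, hφ, comp_zero]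

theorem IsKernelMap.comp [HasCokernels C] (hC : AxiomE2 (KernelCokernelPair (C := C)))
    {X Y Z : C} {f : X ⟶ Y} {g : Y ⟶ Z} (hf : IsKernelMap f) (hg : IsKernelMap g) :
    IsKernelMap (f ≫ g) := by
  have := hf.mono
  have := hg.mono
  obtain ⟨Q, c, hfc, ⟨hf⟩⟩ := hf
  obtain ⟨_, hE2⟩ := hC g c (admissibleMono_iff_isKernelMap.2 hg)
  have hpo := IsPushout.of_hasPushout g c
  have := (admissibleMono_iff_isKernelMap.1 (hE2 _ _ hpo)).mono
  obtain ⟨D, d, hgd, ⟨hg⟩⟩ := hg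
  have w : (f ≫ g) ≫ pushout.inl g c = 0 := by
    rw [Category.assoc, hpo.w, reassoc_of% hfc, zero_comp]
  have := mono_comp f g
  refine ⟨_, pushout.inl g c, w, ⟨KernelFork.IsLimit.ofι' _ w fun k hk => ?_⟩⟩
  have hkd : k ≫ d = 0 := by
    rw [← hpo.inl_desc d 0 (hgd.trans comp_zero.symm), reassoc_of% hk, zero_comp]
  obtain ⟨l, rfl : l ≫ g = k⟩ := KernelFork.IsLimit.lift' hg k hkd
  have hlc : l ≫ c = 0 := by
    rw [← cancel_mono (pushout.inr g c), Category.assoc, ← hpo.w, ← Category.assoc, hk, zero_comp]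
  obtain ⟨m, rfl : m ≫ f = l⟩ := KernelFork.IsLimit.lift' hf l hlc
  exact ⟨m, (Category.assoc _ _ _).symm⟩

theorem IsCokernelMap.comp [HasKernels C] (hC : AxiomE2op (KernelCokernelPair (C := C)))
    {X Y Z : C} {f : X ⟶ Y} {g : Y ⟶ Z} (hf : IsCokernelMap f) (hg : IsCokernelMap g) :
    IsCokernelMap (f ≫ g) := by
  have := hf.epi
  have := hg.epi
  obtain ⟨Q, c, hcg, ⟨hg⟩⟩ := hg
  obtain ⟨_, hE2⟩ := hC f c (admissibleEpi_iff_isCokernelMap.2 hf)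
  have hpb := IsPullback.of_hasPullback f c
  have := (admissibleEpi_iff_isCokernelMap.1 (hE2 _ _ hpb)).epi
  obtain ⟨D, d, hdf, ⟨hf⟩⟩ := hf
  have w : pullback.fst f c ≫ f ≫ g = 0 := by
    rw [hpb.w_assoc, hcg, comp_zero]
  have := epi_comp f g
  refine ⟨_, pullback.fst f c, w, ⟨CokernelCofork.IsColimit.ofπ' _ w fun k hk => ?_⟩⟩
  have hdk : d ≫ k = 0 := by
    rw [← hpb.lift_fst d 0 (hdf.trans zero_comp.symm), Category.assoc, hk, comp_zero]
  obtain ⟨l, rfl : f ≫ l = k⟩ := CokernelCofork.IsColimit.desc' hf k hdk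
  have hcl : c ≫ l = 0 := by
    rw [← cancel_epi (pullback.snd f c), ← hpb.w_assoc, hk, comp_zero]
  obtain ⟨m, rfl : g ≫ m = l⟩ := CokernelCofork.IsColimit.desc' hg l hcl
  exact ⟨m, Category.assoc _ _ _⟩

theorem IsQuasiAbelian.isExactStructure (hC : IsQuasiAbelian C) :
    IsExactStructure (KernelCokernelPair (C := C)) :=
  have := hC.hasKernels
  have := hC.hasCokernels
  { kernelCokernelPair := fun _ h => h
    of_iso := fun _ _ ⟨e⟩ h => h.of_iso e
    e0 := fun X => admissibleMono_iff_isKernelMap.2 (isKernelMap_id X)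
    e0op := fun X => admissibleEpi_iff_isCokernelMap.2 (isCokernelMap_id X)
    e1 := fun f g => by
      simp only [admissibleMono_iff_isKernelMap]
      exact IsKernelMap.comp hC.e2
    e1op := fun f g => by
      simp only [admissibleEpi_iff_isCokernelMap]
      exact IsCokernelMap.comp hC.e2op
    e2 := hC.e2
    e2op := hC.e2op }

end ExactCat

namespace OpMod

section QuotientSeminorm

variable {𝕜 V W : Type*} [NormedField 𝕜] [AddCommGroup V] [Module 𝕜 V] [AddCommGroup W]
  [Module 𝕜 W]

theorem bddBelow_range_fiber (p : Seminorm 𝕜 V) (π : V →ₗ[𝕜] W) (w : W) :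
    BddBelow (Set.range fun v : {v // π v = w} => p v) :=
  ⟨0, Set.forall_mem_range.2 fun _ => apply_nonneg p _⟩

/-- The quotient seminorm on the target of a surjective linear map: the infimum of a seminorm
over the fibres. -/
noncomputable def quotientSeminorm (p : Seminorm 𝕜 V) {π : V →ₗ[𝕜] W}
    (hπ : Function.Surjective π) : Seminorm 𝕜 W :=
  have hfib (w : W) : Nonempty {v // π v = w} := (hπ w).elim fun v hv => ⟨v, hv⟩
  have hle (v : V) {w : W} (hv : π v = w) : ⨅ v : {v // π v = w}, p v ≤ p v :=
    ciInf_le (bddBelow_range_fiber p π w) ⟨v, hv⟩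
  Seminorm.ofSMulLE (fun w => ⨅ v : {v // π v = w}, p v)
    (le_antisymm ((hle 0 (map_zero π)).trans_eq (map_zero p))
      (Real.iInf_nonneg fun _ => apply_nonneg p _))
    (fun w w' => le_ciInf_add_ciInf fun v v' =>
      (hle (v + v') (by rw [map_add, v.2, v'.2])).trans (map_add_le_add p _ _))
    (fun c w => by
      rw [Real.mul_iInf_of_nonneg (norm_nonneg c)]
      exact le_ciInf fun v => (hle (c • (v : V)) (by rw [map_smul, v.2])).trans_eq
        (map_smul_eq_mul p c _))

variable {p : Seminorm 𝕜 V} {π : V →ₗ[𝕜] W} (hπ : Function.Surjective π)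

theorem quotientSeminorm_map_le (v : V) : quotientSeminorm p hπ (π v) ≤ p v :=
  ciInf_le (bddBelow_range_fiber p π _) ⟨v, rfl⟩

theorem exists_lt_of_quotientSeminorm_lt {w : W} {r : ℝ} (h : quotientSeminorm p hπ w < r) :
    ∃ v, π v = w ∧ p v < r := by
  have : Nonempty {v // π v = w} := (hπ w).elim fun v hv => ⟨v, hv⟩
  obtain ⟨v, hv⟩ := exists_lt_of_ciInf_lt h
  exact ⟨v, v.2, hv⟩

theorem le_mul_quotientSeminorm {w : W} {b K : ℝ} (hK : 0 ≤ K)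
    (h : ∀ v, π v = w → b ≤ K * p v) : b ≤ K * quotientSeminorm p hπ w := by
  have : Nonempty {v // π v = w} := (hπ w).elim fun v hv => ⟨v, hv⟩
  refine (le_ciInf fun v : {v // π v = w} => h v v.2).trans_eq ?_
  exact (Real.mul_iInf_of_nonneg hK _).symm

end QuotientSeminorm

/-! ### Matrices over operator spaces -/

section Algebra

variable {E : Type u} [AddCommGroup E] [Module ℂ E] {F : Type v} [AddCommGroup F] [Module ℂ F]

theorem exists_map_eq {α β m n : Type*} {f : α → β} {y : Matrix m n β}
    (h : ∀ i j, y i j ∈ Set.range f) : ∃ x : Matrix m n α, x.map f = y := by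
  choose x hx using h
  exact ⟨x, funext₂ hx⟩

theorem blocks_map {m n : ℕ} {α β : Type*} (f : α → β) (x : Matrix (Fin m) (Fin m) α)
    (y : Matrix (Fin m) (Fin n) α) (z : Matrix (Fin n) (Fin m) α) (t : Matrix (Fin n) (Fin n) α) :
    (blocks x y z t).map f = blocks (x.map f) (y.map f) (z.map f) (t.map f) := by
  simp only [blocks, Matrix.reindex_apply, ← Matrix.submatrix_map, Matrix.fromBlocks_map]

theorem blocks_zero_zero_map {m n : ℕ} (f : E →ₗ[ℂ] F) (x : Matrix (Fin m) (Fin m) E)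
    (y : Matrix (Fin n) (Fin n) E) :
    (blocks x 0 0 y).map f = blocks (x.map f) 0 0 (y.map f) := by
  simp only [blocks_map, Matrix.map_zero _ (map_zero f)]

theorem blocks_submatrix_castAdd_castAdd {m n : ℕ} {α : Type*} (x : Matrix (Fin m) (Fin m) α)
    (y : Matrix (Fin m) (Fin n) α) (z : Matrix (Fin n) (Fin m) α) (t : Matrix (Fin n) (Fin n) α) :
    (blocks x y z t).submatrix (Fin.castAdd n) (Fin.castAdd n) = x := by
  ext i j
  simp [blocks]

theorem blocks_submatrix_castAdd_natAdd {m n : ℕ} {α : Type*} (x : Matrix (Fin m) (Fin m) α)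
    (y : Matrix (Fin m) (Fin n) α) (z : Matrix (Fin n) (Fin m) α) (t : Matrix (Fin n) (Fin n) α) :
    (blocks x y z t).submatrix (Fin.castAdd n) (Fin.natAdd m) = y := by
  ext i j
  simp [blocks]

theorem blocks_submatrix_natAdd_natAdd {m n : ℕ} {α : Type*} (x : Matrix (Fin m) (Fin m) α)
    (y : Matrix (Fin m) (Fin n) α) (z : Matrix (Fin n) (Fin m) α) (t : Matrix (Fin n) (Fin n) α) :
    (blocks x y z t).submatrix (Fin.natAdd m) (Fin.natAdd m) = t := by
  ext i j
  simp [blocks]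

theorem scalarMul_map {m n : ℕ} (f : E →ₗ[ℂ] F) (α : Matrix (Fin n) (Fin m) ℂ)
    (x : Matrix (Fin m) (Fin m) E) (β : Matrix (Fin m) (Fin n) ℂ) :
    (scalarMul α x β).map f = scalarMul α (x.map f) β := by
  ext i j
  simp [scalarMul]

theorem scalarMul_diagonal {n : ℕ} (p q : Fin n → ℂ) (x : Matrix (Fin n) (Fin n) E) :
    scalarMul (Matrix.diagonal p) x (Matrix.diagonal q) =
      Matrix.of fun i j => (p i * q j) • x i j := by
  ext i j
  simp [scalarMul, Matrix.diagonal_apply]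

theorem scalarMul_one_submatrix {m n : ℕ} (x : Matrix (Fin m) (Fin m) E) (e f : Fin n → Fin m) :
    scalarMul ((1 : Matrix (Fin m) (Fin m) ℂ).submatrix e id) x
      ((1 : Matrix (Fin m) (Fin m) ℂ).submatrix id f) = x.submatrix e f := by
  ext i j
  simp [scalarMul, Matrix.one_apply]

end Algebra

section Norm

open scoped Matrix.Norms.L2Operator

theorem norm_diagonal_le_one {n : ℕ} {p : Fin n → ℂ} (hp : ∀ i, ‖p i‖ ≤ 1) :
    ‖Matrix.diagonal p‖ ≤ 1 :=
  (Matrix.l2_opNorm_diagonal p).trans_le ((pi_norm_le_iff_of_nonneg zero_le_one).2 hp)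

theorem norm_one_submatrix_id_right_le_one {m n : ℕ} {f : Fin n → Fin m}
    (hf : Function.Injective f) : ‖(1 : Matrix (Fin m) (Fin m) ℂ).submatrix id f‖ ≤ 1 := by
  set s := (1 : Matrix (Fin m) (Fin m) ℂ).submatrix id f
  have hs : s.conjTranspose * s = 1 := by
    rw [Matrix.conjTranspose_submatrix, Matrix.conjTranspose_one,
      ← Matrix.submatrix_mul _ _ _ _ _ Function.bijective_id, one_mul, Matrix.submatrix_one f hf]
  have hn : ‖s‖ * ‖s‖ ≤ 1 := by
    rw [← Matrix.l2_opNorm_conjTranspose_mul_self, hs, ← Matrix.diagonal_one]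
    exact norm_diagonal_le_one fun _ => norm_one.le
  exact (mul_self_le_mul_self_iff (norm_nonneg s) zero_le_one).2 (by rwa [one_mul])

theorem norm_one_submatrix_id_left_le_one {m n : ℕ} {e : Fin n → Fin m}
    (he : Function.Injective e) : ‖(1 : Matrix (Fin m) (Fin m) ℂ).submatrix e id‖ ≤ 1 := by
  rw [← Matrix.l2_opNorm_conjTranspose, Matrix.conjTranspose_submatrix, Matrix.conjTranspose_one]
  exact norm_one_submatrix_id_right_le_one he

variable {E : Type u} [NormedAddCommGroup E] [NormedSpace ℂ E] [OperatorSpace E]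

theorem matNorm_scalarMul_le_of_norm_le_one {m n : ℕ} {α : Matrix (Fin n) (Fin m) ℂ}
    {β : Matrix (Fin m) (Fin n) ℂ} (hα : ‖α‖ ≤ 1) (hβ : ‖β‖ ≤ 1) (x : Matrix (Fin m) (Fin m) E) :
    OperatorSpace.matNorm n (scalarMul α x β) ≤ OperatorSpace.matNorm m x := by
  have := apply_nonneg (OperatorSpace.matNorm (E := E) m) x
  calc OperatorSpace.matNorm n (scalarMul α x β)
      ≤ ‖α‖ * OperatorSpace.matNorm m x * ‖β‖ := OperatorSpace.matNorm_scalarMul α x β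
    _ ≤ 1 * OperatorSpace.matNorm m x * 1 := by gcongr
    _ = OperatorSpace.matNorm m x := by rw [one_mul, mul_one]

theorem matNorm_submatrix_le {m n : ℕ} (x : Matrix (Fin m) (Fin m) E) {e f : Fin n → Fin m}
    (he : Function.Injective e) (hf : Function.Injective f) :
    OperatorSpace.matNorm n (x.submatrix e f) ≤ OperatorSpace.matNorm m x := by
  rw [← scalarMul_one_submatrix]
  exact matNorm_scalarMul_le_of_norm_le_one (norm_one_submatrix_id_left_le_one he)
    (norm_one_submatrix_id_right_le_one hf) x

theorem norm_apply_le_matNorm {n : ℕ} (x : Matrix (Fin n) (Fin n) E) (i j : Fin n) :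
    ‖x i j‖ ≤ OperatorSpace.matNorm n x := by
  have h := matNorm_submatrix_le x (e := fun _ : Fin 1 => i) (f := fun _ : Fin 1 => j)
    (Function.injective_of_subsingleton _) (Function.injective_of_subsingleton _)
  rwa [OperatorSpace.matNorm_one] at h

theorem eq_zero_of_matNorm_eq_zero {n : ℕ} {x : Matrix (Fin n) (Fin n) E}
    (h : OperatorSpace.matNorm n x = 0) : x = 0 := by
  ext i j
  exact norm_le_zero_iff.1 ((norm_apply_le_matNorm x i j).trans_eq h)

theorem rectNorm_nonneg {m n : ℕ} (x : Matrix (Fin m) (Fin n) E) : 0 ≤ rectNorm x :=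
  apply_nonneg _ _

theorem rectNorm_submatrix_le {m n : ℕ} (z : Matrix (Fin (m + n)) (Fin (m + n)) E) :
    rectNorm (z.submatrix (Fin.castAdd n) (Fin.natAdd m)) ≤ OperatorSpace.matNorm (m + n) z := by
  let p : Fin (m + n) → ℂ := Fin.append 1 0
  let q : Fin (m + n) → ℂ := Fin.append 0 1
  have hcorner : blocks 0 (z.submatrix (Fin.castAdd n) (Fin.natAdd m)) 0 0 =
      scalarMul (Matrix.diagonal p) z (Matrix.diagonal q) := by
    rw [scalarMul_diagonal]
    ext i j
    cases i using Fin.addCases <;> cases j using Fin.addCases <;> simp [blocks, p, q]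
  rw [rectNorm, hcorner]
  refine matNorm_scalarMul_le_of_norm_le_one (norm_diagonal_le_one fun i => ?_)
    (norm_diagonal_le_one fun i => ?_) z
  · cases i using Fin.addCases <;> simp [p]
  · cases i using Fin.addCases <;> simp [q]

theorem rectNorm_le_matNorm {n : ℕ} (x : Matrix (Fin n) (Fin n) E) :
    rectNorm x ≤ OperatorSpace.matNorm n x := by
  let swap : Fin (n + n) ≃ Fin (n + n) :=
    finSumFinEquiv.symm.trans ((Equiv.sumComm _ _).trans finSumFinEquiv)
  have hswap : (blocks 0 0 0 x).submatrix swap id = blocks 0 x 0 0 := by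
    ext i j
    obtain ⟨i, rfl⟩ := finSumFinEquiv.surjective i
    obtain ⟨j, rfl⟩ := finSumFinEquiv.surjective j
    cases i <;> cases j <;>
      simp only [blocks, Matrix.reindex_apply, Matrix.submatrix_apply, swap, Equiv.trans_apply,
        Equiv.symm_apply_apply, Equiv.sumComm_apply, Sum.swap_inl, Sum.swap_inr, id] <;>
      rfl
  calc rectNorm x = OperatorSpace.matNorm (n + n) ((blocks 0 0 0 x).submatrix swap id) := by
        rw [hswap, rectNorm]
    _ ≤ OperatorSpace.matNorm (n + n) (blocks 0 0 0 x) :=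
        matNorm_submatrix_le _ swap.injective Function.injective_id
    _ = OperatorSpace.matNorm n x := by
        rw [OperatorSpace.matNorm_blocks, map_zero, max_eq_right (apply_nonneg _ x)]

end Norm

/-! ### Submodules, quotients and products of operator spaces -/

section Submodule

variable {E : Type u} [NormedAddCommGroup E] [NormedSpace ℂ E] [OperatorSpace E]
  (N : Submodule ℂ E) [hN : IsClosed (N : Set E)]

noncomputable instance : OperatorSpace N where
  toCompleteSpace := hN.completeSpace_coe
  matNorm n := (OperatorSpace.matNorm n).comp N.subtype.mapMatrix
  matNorm_one x := by
    rw [Seminorm.comp_apply, OperatorSpace.matNorm_one]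
    rfl
  matNorm_blocks x y := by
    simp only [Seminorm.comp_apply, LinearMap.mapMatrix_apply, blocks_zero_zero_map,
      OperatorSpace.matNorm_blocks]
  matNorm_scalarMul α x β := by
    simp only [Seminorm.comp_apply, LinearMap.mapMatrix_apply, scalarMul_map]
    exact OperatorSpace.matNorm_scalarMul _ _ _

theorem matNorm_submodule {n : ℕ} (x : Matrix (Fin n) (Fin n) N) :
    OperatorSpace.matNorm n x = OperatorSpace.matNorm n (x.map N.subtype) :=
  rfl

theorem rectNorm_submodule {m n : ℕ} (x : Matrix (Fin m) (Fin n) N) :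
    rectNorm x = rectNorm (x.map N.subtype) := by
  simp only [rectNorm, matNorm_submodule, blocks_map, Matrix.map_zero _ (map_zero N.subtype)]

end Submodule

section Quotient

theorem mapMatrix_mkQ_surjective {E m n : Type*} [AddCommGroup E] [Module ℂ E]
    (N : Submodule ℂ E) :
    Function.Surjective (N.mkQ.mapMatrix : Matrix m n E →ₗ[ℂ] Matrix m n (E ⧸ N)) :=
  fun _ => exists_map_eq fun _ _ => N.mkQ_surjective _

variable {E : Type u} [NormedAddCommGroup E] [NormedSpace ℂ E] [OperatorSpace E]
  (N : Submodule ℂ E)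

/-- The quotient norm on `M_n(E ⧸ N)`: the infimum of the norms of the entrywise lifts to
`M_n(E)`. -/
noncomputable def quotientMatNorm (n : ℕ) : Seminorm ℂ (Matrix (Fin n) (Fin n) (E ⧸ N)) :=
  quotientSeminorm (OperatorSpace.matNorm n) (mapMatrix_mkQ_surjective N)

theorem quotientMatNorm_map_mkQ_le {n : ℕ} (y : Matrix (Fin n) (Fin n) E) :
    quotientMatNorm N n (y.map N.mkQ) ≤ OperatorSpace.matNorm n y :=
  quotientSeminorm_map_le (mapMatrix_mkQ_surjective N) y

theorem exists_matNorm_lt_of_quotientMatNorm_lt {n : ℕ} {x : Matrix (Fin n) (Fin n) (E ⧸ N)}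
    {r : ℝ} (h : quotientMatNorm N n x < r) :
    ∃ y : Matrix (Fin n) (Fin n) E, y.map N.mkQ = x ∧ OperatorSpace.matNorm n y < r :=
  exists_lt_of_quotientSeminorm_lt (mapMatrix_mkQ_surjective N) h

theorem quotientMatNorm_one (x : Matrix (Fin 1) (Fin 1) (E ⧸ N)) :
    quotientMatNorm N 1 x = ‖x 0 0‖ := by
  refine le_antisymm (le_of_forall_gt fun r hr => ?_) (le_of_forall_gt fun r hr => ?_)
  · obtain ⟨y, hy, hlt⟩ := Submodule.Quotient.norm_mk_lt (x 0 0) (sub_pos.2 hr)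
    have hx : Matrix.map !![y] N.mkQ = x := by
      ext i j
      rw [Subsingleton.elim i 0, Subsingleton.elim j 0]
      exact hy
    calc quotientMatNorm N 1 x
        ≤ OperatorSpace.matNorm 1 !![y] := hx ▸ quotientMatNorm_map_mkQ_le N _
      _ = ‖y‖ := OperatorSpace.matNorm_one _
      _ < r := by linarith
  · obtain ⟨y, rfl, hy⟩ := exists_matNorm_lt_of_quotientMatNorm_lt N hr
    rw [OperatorSpace.matNorm_one] at hy
    exact (Submodule.Quotient.norm_mk_le N (y 0 0)).trans_lt hy

theorem quotientMatNorm_blocks {m n : ℕ} (x : Matrix (Fin m) (Fin m) (E ⧸ N))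
    (y : Matrix (Fin n) (Fin n) (E ⧸ N)) :
    quotientMatNorm N (m + n) (blocks x 0 0 y) =
      max (quotientMatNorm N m x) (quotientMatNorm N n y) := by
  refine le_antisymm (le_of_forall_gt fun r hr => ?_) (le_of_forall_gt fun r hr => ?_)
  · obtain ⟨a, rfl, ha⟩ := exists_matNorm_lt_of_quotientMatNorm_lt N (max_lt_iff.1 hr).1
    obtain ⟨b, rfl, hb⟩ := exists_matNorm_lt_of_quotientMatNorm_lt N (max_lt_iff.1 hr).2
    have hab := quotientMatNorm_map_mkQ_le N (blocks a 0 0 b)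
    rw [blocks_zero_zero_map, OperatorSpace.matNorm_blocks] at hab
    exact hab.trans_lt (max_lt ha hb)
  · obtain ⟨z, hz, hlt⟩ := exists_matNorm_lt_of_quotientMatNorm_lt N hr
    have hx : (z.submatrix (Fin.castAdd n) (Fin.castAdd n)).map N.mkQ = x := by
      rw [← Matrix.submatrix_map, hz, blocks_submatrix_castAdd_castAdd]
    have hy : (z.submatrix (Fin.natAdd m) (Fin.natAdd m)).map N.mkQ = y := by
      rw [← Matrix.submatrix_map, hz, blocks_submatrix_natAdd_natAdd]
    rw [← hx, ← hy]
    exact (max_le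
      ((quotientMatNorm_map_mkQ_le N _).trans <| matNorm_submatrix_le z
        (Fin.castAdd_injective m n) (Fin.castAdd_injective m n))
      ((quotientMatNorm_map_mkQ_le N _).trans <| matNorm_submatrix_le z
        (Fin.natAdd_injective n m) (Fin.natAdd_injective n m))).trans_lt hlt

open scoped Matrix.Norms.L2Operator in
theorem quotientMatNorm_scalarMul_le {m n : ℕ} (α : Matrix (Fin n) (Fin m) ℂ)
    (x : Matrix (Fin m) (Fin m) (E ⧸ N)) (β : Matrix (Fin m) (Fin n) ℂ) :
    quotientMatNorm N n (scalarMul α x β) ≤ ‖α‖ * quotientMatNorm N m x * ‖β‖ := by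
  rw [mul_right_comm]
  refine le_mul_quotientSeminorm _ (by positivity) ?_
  rintro a rfl
  rw [LinearMap.mapMatrix_apply, ← scalarMul_map, mul_right_comm]
  exact (quotientMatNorm_map_mkQ_le N _).trans (OperatorSpace.matNorm_scalarMul α a β)

variable [hN : IsClosed (N : Set E)]

noncomputable instance : OperatorSpace (E ⧸ N) where
  toCompleteSpace := Submodule.Quotient.completeSpace N
  matNorm := quotientMatNorm N
  matNorm_one := quotientMatNorm_one N
  matNorm_blocks := quotientMatNorm_blocks N
  matNorm_scalarMul := quotientMatNorm_scalarMul_le N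

theorem exists_rectNorm_lt_of_quotient {m n : ℕ} {x : Matrix (Fin m) (Fin n) (E ⧸ N)} {r : ℝ}
    (h : rectNorm x < r) :
    ∃ y : Matrix (Fin m) (Fin n) E, y.map N.mkQ = x ∧ rectNorm y < r := by
  obtain ⟨z, hz, hlt⟩ := exists_matNorm_lt_of_quotientMatNorm_lt N h
  refine ⟨z.submatrix (Fin.castAdd n) (Fin.natAdd m), ?_, (rectNorm_submatrix_le z).trans_lt hlt⟩
  rw [← Matrix.submatrix_map, hz, blocks_submatrix_castAdd_natAdd]

end Quotient

section Prod

variable {E : Type u} [NormedAddCommGroup E] [NormedSpace ℂ E] [OperatorSpace E]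
  {F : Type v} [NormedAddCommGroup F] [NormedSpace ℂ F] [OperatorSpace F]

open scoped Matrix.Norms.L2Operator in
noncomputable instance : OperatorSpace (E × F) where
  matNorm n := (OperatorSpace.matNorm n).comp (LinearMap.fst ℂ E F).mapMatrix ⊔
    (OperatorSpace.matNorm n).comp (LinearMap.snd ℂ E F).mapMatrix
  matNorm_one x := by
    rw [Seminorm.sup_apply, Seminorm.comp_apply, Seminorm.comp_apply, OperatorSpace.matNorm_one,
      OperatorSpace.matNorm_one]
    rfl
  matNorm_blocks x y := by
    simp only [Seminorm.sup_apply, Seminorm.comp_apply, LinearMap.mapMatrix_apply,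
      blocks_zero_zero_map, OperatorSpace.matNorm_blocks]
    exact max_max_max_comm _ _ _ _
  matNorm_scalarMul α x β := by
    simp only [Seminorm.sup_apply, Seminorm.comp_apply, LinearMap.mapMatrix_apply, scalarMul_map]
    rw [mul_right_comm, mul_max_of_nonneg _ _ (by positivity)]
    exact max_le_max ((OperatorSpace.matNorm_scalarMul _ _ _).trans_eq (mul_right_comm _ _ _))
      ((OperatorSpace.matNorm_scalarMul _ _ _).trans_eq (mul_right_comm _ _ _))

theorem matNorm_prod {n : ℕ} (x : Matrix (Fin n) (Fin n) (E × F)) :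
    OperatorSpace.matNorm n x = max (OperatorSpace.matNorm n (x.map (LinearMap.fst ℂ E F)))
      (OperatorSpace.matNorm n (x.map (LinearMap.snd ℂ E F))) :=
  rfl

theorem rectNorm_prod {m n : ℕ} (x : Matrix (Fin m) (Fin n) (E × F)) :
    rectNorm x = max (rectNorm (x.map (LinearMap.fst ℂ E F)))
      (rectNorm (x.map (LinearMap.snd ℂ E F))) := by
  simp only [rectNorm, matNorm_prod, blocks_map, Matrix.map_zero _ (map_zero _)]

end Prod

noncomputable instance : OperatorSpace PUnit.{u + 1} where
  matNorm _ := 0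
  matNorm_one _ := rfl
  matNorm_blocks _ _ := (max_self 0).symm
  matNorm_scalarMul _ _ _ := by
    simp only [zero_apply, mul_zero, zero_mul, le_refl]

section Action

variable {H : Type v} [NormedAddCommGroup H] [InnerProductSpace ℂ H]
  {A : NonUnitalSubalgebra ℂ (H →L[ℂ] H)}

theorem opNorm_nonneg {m n : ℕ} (a : Matrix (Fin m) (Fin n) A) : 0 ≤ opNorm a :=
  norm_nonneg (matrixOp (a.map fun b => (b : H →L[ℂ] H)))

theorem opNorm_one_le (a : Matrix (Fin 1) (Fin 1) A) : opNorm a ≤ ‖(a 0 0 : H →L[ℂ] H)‖ := by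
  refine ContinuousLinearMap.opNorm_le_bound _ (norm_nonneg _) fun x => ?_
  simpa [PiLp.norm_eq_of_L2, matrixOp] using (a 0 0 : H →L[ℂ] H).le_opNorm (x 0)

section ActMul

variable {E : Type u} [NormedAddCommGroup E] [NormedSpace ℂ E]

/-- The matrix product `x · a` of a matrix over a right `A`-module and a matrix over `A`. -/
def actMul (act : E →ₗ[ℂ] A →ₗ[ℂ] E) {m n p : ℕ} (x : Matrix (Fin m) (Fin p) E)
    (a : Matrix (Fin p) (Fin n) A) : Matrix (Fin m) (Fin n) E :=
  Matrix.of fun i j => ∑ k, act (x i k) (a k j)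

theorem map_actMul {F : Type w} [NormedAddCommGroup F] [NormedSpace ℂ F]
    {act : E →ₗ[ℂ] A →ₗ[ℂ] E} {act' : F →ₗ[ℂ] A →ₗ[ℂ] F} {f : E →ₗ[ℂ] F}
    (hf : ∀ x a, f (act x a) = act' (f x) a) {m n p : ℕ} (x : Matrix (Fin m) (Fin p) E)
    (a : Matrix (Fin p) (Fin n) A) :
    (actMul act x a).map f = actMul act' (x.map f) a := by
  ext i j
  simp [actMul, hf]

theorem odot_map_lift (act : E →ₗ[ℂ] A →ₗ[ℂ] E) {n p : ℕ} (x : Matrix (Fin n) (Fin p) E)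
    (a : Matrix (Fin p) (Fin n) A) :
    (odot x a).map (TensorProduct.lift act) = actMul act x a := by
  ext i j
  simp [odot, actMul]

theorem matNorm_map_lift_le_haagerupNorm_iff [OperatorSpace E] (act : E →ₗ[ℂ] A →ₗ[ℂ] E) :
    (∀ (n : ℕ) (t : Matrix (Fin n) (Fin n) (E ⊗[ℂ] A)),
      OperatorSpace.matNorm n (t.map (TensorProduct.lift act)) ≤ haagerupNorm t) ↔
    ∀ (n p : ℕ) (x : Matrix (Fin n) (Fin p) E) (a : Matrix (Fin p) (Fin n) A),
      OperatorSpace.matNorm n (actMul act x a) ≤ rectNorm x * opNorm a := by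
  refine ⟨fun h n p x a => ?_, fun h n t => ?_⟩
  · rw [← odot_map_lift]
    refine (h n _).trans (csInf_le ⟨0, ?_⟩ ⟨p, x, a, rfl, rfl⟩)
    rintro r ⟨p, x, a, -, rfl⟩
    exact mul_nonneg (rectNorm_nonneg x) (opNorm_nonneg a)
  · obtain ⟨p, x, a, ht⟩ := exists_eq_odot t
    refine le_csInf ⟨_, p, x, a, ht, rfl⟩ ?_
    rintro r ⟨p, x, a, rfl, rfl⟩
    rw [odot_map_lift]
    exact h n p x a

end ActMul

/-- A subalgebra of `B(H)` with a bounded right approximate unit: a net, here a filter, with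
`a e → a` for all `a`. -/
class HasBoundedRightApproximateUnit (A : NonUnitalSubalgebra ℂ (H →L[ℂ] H)) : Prop where
  exists_tendsto : ∃ (l : Filter A) (C : ℝ), l.NeBot ∧
    (∀ a : A, Filter.Tendsto (a * ·) l (nhds a)) ∧ ∀ᶠ e : A in l, ‖(e : H →L[ℂ] H)‖ ≤ C

theorem IsOperatorAlgebra.hasBoundedRightApproximateUnit (hA : IsOperatorAlgebra A) :
    HasBoundedRightApproximateUnit A :=
  let ⟨l, hl, hle⟩ := hA.exists_approximateUnit
  ⟨l, 1, hl.neBot, hl.tendsto_mul_left, hle⟩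

end Action

end OpMod

namespace OMod

/-! ### Operator modules -/

variable {H : Type v} [NormedAddCommGroup H] [InnerProductSpace ℂ H]
  {A : NonUnitalSubalgebra ℂ (H →L[ℂ] H)}

section Morphisms

variable {E F G : OMod.{u} A}

@[ext]
theorem hom_ext {f g : E ⟶ F} (h : ∀ x, lin f x = lin g x) : f = g :=
  Subtype.ext (LinearMap.ext h)

theorem map_lin_comp (f : E ⟶ F) (g : F ⟶ G) {m n : Type*} (x : Matrix m n E) :
    x.map (lin (f ≫ g)) = (x.map (lin f)).map (lin g) :=
  rfl

theorem lin_act (f : E ⟶ F) (x : E) (a : A) : lin f (E.act x a) = F.act (lin f x) a :=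
  f.2.1 x a

theorem comp_eq_zero_iff {f : E ⟶ F} {g : F ⟶ G} :
    f ≫ g = 0 ↔ LinearMap.range (lin f) ≤ LinearMap.ker (lin g) := by
  rw [LinearMap.range_le_ker_iff]
  exact ⟨congrArg lin, fun h => Subtype.ext h⟩

theorem mnorm_nonneg {n : ℕ} (x : Matrix (Fin n) (Fin n) E) : 0 ≤ mnorm x :=
  apply_nonneg (OperatorSpace.matNorm n) x

theorem mnorm_one (x : Matrix (Fin 1) (Fin 1) E) : mnorm x = ‖x 0 0‖ :=
  OperatorSpace.matNorm_one x

theorem mnorm_add_le {n : ℕ} (x y : Matrix (Fin n) (Fin n) E) :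
    mnorm (x + y) ≤ mnorm x + mnorm y :=
  map_add_le_add (OperatorSpace.matNorm n) x y

theorem mnorm_smul {n : ℕ} (c : ℂ) (x : Matrix (Fin n) (Fin n) E) :
    mnorm (c • x) = ‖c‖ * mnorm x :=
  map_smul_eq_mul (OperatorSpace.matNorm n) c x

theorem exists_mnorm_map_le (f : E ⟶ F) : ∃ c : ℝ≥0,
    ∀ (n : ℕ) (x : Matrix (Fin n) (Fin n) E), mnorm (x.map (lin f)) ≤ c * mnorm x := by
  obtain ⟨c, hc⟩ := f.2.2
  exact ⟨c.toNNReal, fun n x => (hc n x).trans <|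
    mul_le_mul_of_nonneg_right (Real.le_coe_toNNReal c) (mnorm_nonneg x)⟩

theorem continuous_lin (f : E ⟶ F) : Continuous (lin f) := by
  obtain ⟨c, hc⟩ := exists_mnorm_map_le f
  exact AddMonoidHomClass.continuous_of_bound (lin f) c fun x => by
    simpa only [mnorm_one] using! hc 1 !![x]

theorem isClosed_ker (f : E ⟶ F) : IsClosed (LinearMap.ker (lin f) : Set E) :=
  isClosed_singleton.preimage (continuous_lin f)

/-- The morphism given by a completely bounded module map. -/
def homMk (f : E →ₗ[ℂ] F) (hact : ∀ x a, f (E.act x a) = F.act (f x) a)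
    (hcb : ∃ c : ℝ≥0, ∀ (n : ℕ) (x : Matrix (Fin n) (Fin n) E), mnorm (x.map f) ≤ c * mnorm x) :
    E ⟶ F :=
  ⟨f, hact, hcb.elim fun c hc => ⟨c, hc⟩⟩

/-- The morphism given by a completely contractive module map. -/
def homMkOfContractive (f : E →ₗ[ℂ] F) (hact : ∀ x a, f (E.act x a) = F.act (f x) a)
    (hcc : ∀ (n : ℕ) (x : Matrix (Fin n) (Fin n) E), mnorm (x.map f) ≤ mnorm x) : E ⟶ F :=
  homMk f hact ⟨1, fun n x => (hcc n x).trans_eq (one_mul _).symm⟩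

end Morphisms

section Action

variable (E : OMod.{u} A)

theorem matNorm_actMul_le {n p : ℕ} (x : Matrix (Fin n) (Fin p) E) (a : Matrix (Fin p) (Fin n) A) :
    OperatorSpace.matNorm n (actMul E.act x a) ≤ rectNorm x * opNorm a :=
  (matNorm_map_lift_le_haagerupNorm_iff E.act).1 E.act_completelyContractive n p x a

theorem norm_act_le (x : E) (a : A) : ‖E.act x a‖ ≤ ‖x‖ * ‖(a : H →L[ℂ] H)‖ :=
  calc ‖E.act x a‖ = OperatorSpace.matNorm 1 (actMul E.act !![x] !![a]) := by
        simp [OperatorSpace.matNorm_one, actMul]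
    _ ≤ rectNorm !![x] * opNorm !![a] := E.matNorm_actMul_le _ _
    _ ≤ ‖x‖ * ‖(a : H →L[ℂ] H)‖ := by
        refine mul_le_mul ((rectNorm_le_matNorm _).trans_eq ?_) (opNorm_one_le _) (opNorm_nonneg _)
          (norm_nonneg x)
        rw [OperatorSpace.matNorm_one]
        rfl

theorem continuous_act_right (x : E) : Continuous (E.act x) :=
  AddMonoidHomClass.continuous_of_bound (E.act x) ‖x‖ (E.norm_act_le x)

theorem continuous_act_left (a : A) : Continuous fun x => E.act x a :=
  AddMonoidHomClass.continuous_of_bound (E.act.flip a) ‖(a : H →L[ℂ] H)‖ fun x =>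
    (E.norm_act_le x a).trans_eq (mul_comm _ _)

theorem tendsto_act_of_mem_span {l : Filter A}
    (hl : ∀ a : A, Filter.Tendsto (a * ·) l (nhds a)) {x : E}
    (hx : x ∈ Submodule.span ℂ {z : E | ∃ x a, z = E.act x a}) :
    Filter.Tendsto (fun e => E.act x e) l (nhds x) := by
  induction hx using Submodule.span_induction with
  | mem x hx =>
    obtain ⟨x, a, rfl⟩ := hx
    simp only [← E.act_mul]
    exact ((E.continuous_act_right x).tendsto a).comp (hl a)
  | zero => simp only [map_zero, LinearMap.zero_apply, tendsto_const_nhds]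
  | add x y _ _ hx hy => simpa only [map_add, LinearMap.add_apply] using hx.add hy
  | smul c x _ hx => simpa only [map_smul, LinearMap.smul_apply] using hx.const_smul c

theorem tendsto_act {l : Filter A} {C : ℝ}
    (hl : ∀ a : A, Filter.Tendsto (a * ·) l (nhds a))
    (hC : ∀ᶠ e : A in l, ‖(e : H →L[ℂ] H)‖ ≤ C) (x : E) :
    Filter.Tendsto (fun e => E.act x e) l (nhds x) := by
  rw [Metric.tendsto_nhds]
  intro ε hε
  obtain ⟨y, hy, hxy⟩ := Metric.mem_closure_iff.1 (E.nondegenerate x)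
    (ε / 2 / (|C| + 1)) (by positivity)
  have hye := Metric.tendsto_nhds.1 (E.tendsto_act_of_mem_span hl hy) (ε / 2) (by positivity)
  filter_upwards [hC, hye] with e heC hye
  have hxye : dist (E.act x e) (E.act y e) ≤ dist x y * |C| := by
    rw [dist_eq_norm, dist_eq_norm, ← LinearMap.sub_apply, ← map_sub]
    exact (E.norm_act_le _ _).trans
      (mul_le_mul_of_nonneg_left (heC.trans (le_abs_self C)) (norm_nonneg _))
  calc dist (E.act x e) x
      ≤ dist (E.act x e) (E.act y e) + dist (E.act y e) y + dist y x := dist_triangle4 _ _ _ _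
    _ ≤ dist x y * |C| + dist (E.act y e) y + dist x y := by rw [dist_comm y x]; gcongr
    _ = dist x y * (|C| + 1) + dist (E.act y e) y := by ring
    _ < ε / 2 + ε / 2 := add_lt_add ((lt_div_iff₀ (by positivity)).1 hxy) hye
    _ = ε := add_halves ε

end Action

section Submodule

variable [hA : HasBoundedRightApproximateUnit A] (E : OMod.{u} A) (N : Submodule ℂ E)
  (hN : IsClosed (N : Set E)) (hact : ∀ x ∈ N, ∀ a, E.act x a ∈ N)

/-- A closed submodule of an operator module. The approximate unit of `A` makes it
non-degenerate. -/
noncomputable def ofSubmodule : OMod.{u} A where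
  carrier := N
  act := LinearMap.mk₂ ℂ (fun x a => ⟨E.act x a, hact x x.2 a⟩)
    (fun _ _ _ => Subtype.ext (LinearMap.map_add₂ ..))
    (fun _ _ _ => Subtype.ext (LinearMap.map_smul₂ ..))
    (fun _ _ _ => Subtype.ext (map_add ..)) (fun _ _ _ => Subtype.ext (map_smul ..))
  act_mul x a b := Subtype.ext (E.act_mul x a b)
  act_completelyContractive := by
    rw [matNorm_map_lift_le_haagerupNorm_iff]
    intro n p x a
    rw [matNorm_submodule, rectNorm_submodule, map_actMul fun _ _ => rfl]
    exact E.matNorm_actMul_le _ a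
  nondegenerate x := by
    obtain ⟨l, C, hne, hl, hC⟩ := hA.exists_tendsto
    exact mem_closure_of_tendsto (f := fun e => (⟨E.act x e, hact x x.2 e⟩ : N))
      (tendsto_subtype_rng.2 (E.tendsto_act hl hC x))
      (Filter.Eventually.of_forall fun e => Submodule.subset_span ⟨x, e, rfl⟩)

/-- The inclusion of a closed submodule. -/
noncomputable def submoduleι : ofSubmodule E N hN hact ⟶ E :=
  homMkOfContractive (E := ofSubmodule E N hN hact) N.subtype (fun _ _ => rfl) fun _ _ => le_rfl

theorem range_lin_submoduleι : LinearMap.range (lin (submoduleι E N hN hact)) = N :=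
  N.range_subtype

end Submodule

section Quotient

variable (E : OMod.{u} A) (N : Submodule ℂ E)
  (hN : IsClosed (N : Set E)) (hact : ∀ x ∈ N, ∀ a, E.act x a ∈ N)

/-- The action induced on the quotient by a submodule. -/
noncomputable def quotientAct : E ⧸ N →ₗ[ℂ] A →ₗ[ℂ] E ⧸ N :=
  N.liftQ (E.act.compr₂ N.mkQ) fun x hx =>
    LinearMap.ext fun a => (Submodule.Quotient.mk_eq_zero N).2 (hact x hx a)

theorem matNorm_actMul_quotientAct_le {n p : ℕ} (x : Matrix (Fin n) (Fin p) (E ⧸ N))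
    (a : Matrix (Fin p) (Fin n) A) :
    OperatorSpace.matNorm n (actMul (quotientAct E N hact) x a) ≤ rectNorm x * opNorm a := by
  suffices h : ∀ r, rectNorm x < r →
      OperatorSpace.matNorm n (actMul (quotientAct E N hact) x a) ≤ r * opNorm a from
    ge_of_tendsto ((continuous_mul_const (opNorm a)).continuousWithinAt (s := Set.Ioi _))
      (Filter.eventually_of_mem self_mem_nhdsWithin h)
  intro r hr
  obtain ⟨y, rfl, hy⟩ := exists_rectNorm_lt_of_quotient N hr
  rw [← map_actMul (act := E.act) fun _ _ => rfl]
  exact (quotientMatNorm_map_mkQ_le N _).trans ((E.matNorm_actMul_le y a).trans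
    (mul_le_mul_of_nonneg_right hy.le (opNorm_nonneg a)))

/-- The quotient of an operator module by a closed submodule. -/
noncomputable def quotient : OMod.{u} A where
  carrier := E ⧸ N
  act := quotientAct E N hact
  act_mul x a b := by
    obtain ⟨x, rfl⟩ := N.mkQ_surjective x
    exact congrArg N.mkQ (E.act_mul x a b)
  act_completelyContractive := (matNorm_map_lift_le_haagerupNorm_iff _).2
    fun _ _ => matNorm_actMul_quotientAct_le E N hN hact
  nondegenerate := by
    refine (N.mkQ_surjective.denseRange.dense_image N.continuous_mkQ E.nondegenerate).mono ?_
    rintro _ ⟨x, hx, rfl⟩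
    have hx := Submodule.mem_map_of_mem (f := N.mkQ) hx
    rw [Submodule.map_span] at hx
    refine Submodule.span_mono ?_ hx
    rintro _ ⟨_, ⟨y, a, rfl⟩, rfl⟩
    exact ⟨N.mkQ y, a, rfl⟩

/-- The quotient morphism by a closed submodule. -/
noncomputable def quotientπ : E ⟶ quotient E N hN hact :=
  homMkOfContractive (F := quotient E N hN hact) N.mkQ (fun _ _ => rfl)
    fun _ => quotientMatNorm_map_mkQ_le N

theorem ker_lin_quotientπ : LinearMap.ker (lin (quotientπ E N hN hact)) = N :=
  N.ker_mkQ

end Quotient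

section Prod

theorem dense_span_prod {E F : Type*} [NormedAddCommGroup E] [NormedSpace ℂ E]
    [NormedAddCommGroup F] [NormedSpace ℂ F] {S : Set E} {T : Set F} {U : Set (E × F)}
    (hS : Dense (Submodule.span ℂ S : Set E)) (hT : Dense (Submodule.span ℂ T : Set F))
    (hSU : LinearMap.inl ℂ E F '' S ⊆ U) (hTU : LinearMap.inr ℂ E F '' T ⊆ U) :
    Dense (Submodule.span ℂ U : Set (E × F)) := by
  refine (hS.prod hT).mono ?_
  rw [← Submodule.prod_coe, ← LinearMap.span_inl_union_inr]
  exact Submodule.span_mono (Set.union_subset hSU hTU)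

variable (E F : OMod.{u} A)

/-- The product of two operator modules, with the maximum norms. -/
noncomputable def prod : OMod.{u} A where
  carrier := E × F
  act := LinearMap.mk₂ ℂ (fun x a => (E.act x.1 a, F.act x.2 a))
    (fun _ _ _ => Prod.ext (LinearMap.map_add₂ ..) (LinearMap.map_add₂ ..))
    (fun _ _ _ => Prod.ext (LinearMap.map_smul₂ ..) (LinearMap.map_smul₂ ..))
    (fun _ _ _ => Prod.ext (map_add ..) (map_add ..))
    (fun _ _ _ => Prod.ext (map_smul ..) (map_smul ..))
  act_mul x a b := Prod.ext (E.act_mul x.1 a b) (F.act_mul x.2 a b)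
  act_completelyContractive := by
    rw [matNorm_map_lift_le_haagerupNorm_iff]
    intro n p x a
    rw [matNorm_prod, rectNorm_prod, max_mul_of_nonneg _ _ (opNorm_nonneg a),
      map_actMul (act' := E.act) fun _ _ => rfl, map_actMul (act' := F.act) fun _ _ => rfl]
    exact max_le_max (E.matNorm_actMul_le _ a) (F.matNorm_actMul_le _ a)
  nondegenerate := by
    refine dense_span_prod E.nondegenerate F.nondegenerate ?_ ?_
    · rintro _ ⟨_, ⟨x, a, rfl⟩, rfl⟩
      exact ⟨(x, 0), a, Prod.ext rfl (LinearMap.map_zero₂ F.act a).symm⟩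
    · rintro _ ⟨_, ⟨y, a, rfl⟩, rfl⟩
      exact ⟨(0, y), a, Prod.ext (LinearMap.map_zero₂ E.act a).symm rfl⟩

/-- The first projection of a product of operator modules. -/
noncomputable def prodFst : prod E F ⟶ E :=
  homMkOfContractive (E := prod E F) (LinearMap.fst ℂ E F) (fun _ _ => rfl) fun _ _ =>
    le_max_left _ _

/-- The second projection of a product of operator modules. -/
noncomputable def prodSnd : prod E F ⟶ F :=
  homMkOfContractive (E := prod E F) (LinearMap.snd ℂ E F) (fun _ _ => rfl) fun _ _ =>
    le_max_right _ _

variable {E F}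

/-- The morphism to a product of operator modules with the given components. -/
noncomputable def prodLift {G : OMod.{u} A} (f : G ⟶ E) (g : G ⟶ F) : G ⟶ prod E F :=
  homMk (F := prod E F) ((lin f).prod (lin g))
    (fun x a => Prod.ext (lin_act f x a) (lin_act g x a)) (by
      obtain ⟨c, hc⟩ := exists_mnorm_map_le f
      obtain ⟨d, hd⟩ := exists_mnorm_map_le g
      refine ⟨max c d, fun n x => ?_⟩
      rw [NNReal.coe_max, max_mul_of_nonneg _ _ (mnorm_nonneg x)]
      exact max_le_max (hc n x) (hd n x))

instance : HasBinaryProducts (OMod.{u} A) :=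
  have (E F : OMod.{u} A) : HasLimit (pair E F) :=
    ⟨⟨BinaryFan.mk (prodFst E F) (prodSnd E F),
      BinaryFan.isLimitMk (fun s => prodLift s.fst s.snd) (fun _ => rfl) (fun _ => rfl)
        fun _ _ hfst hsnd => hom_ext fun x => Prod.ext
          (LinearMap.congr_fun (congrArg lin hfst) x)
          (LinearMap.congr_fun (congrArg lin hsnd) x)⟩⟩
  hasBinaryProducts_of_hasLimit_pair _

end Prod

variable (A) in
/-- The zero operator module. -/
noncomputable def zero : OMod.{u} A where
  carrier := PUnit
  act := 0
  act_mul _ _ _ := rfl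
  act_completelyContractive := (matNorm_map_lift_le_haagerupNorm_iff _).2 fun _ _ x a =>
    mul_nonneg (rectNorm_nonneg x) (opNorm_nonneg a)
  nondegenerate x := subset_closure (Subsingleton.elim 0 x ▸ Submodule.zero_mem _)

theorem isZero_zero : IsZero (zero.{u} A) :=
  (IsZero.iff_id_eq_zero _).2 (hom_ext fun _ => rfl)

theorem isAdditive : ExactCat.IsAdditive (OMod.{u} A) where
  hasZeroObject := ⟨zero A, isZero_zero⟩
  hasBinaryProducts := inferInstance

instance : HasBinaryBiproducts (OMod.{u} A) :=
  HasBinaryBiproducts.of_hasBinaryProducts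

/-! ### Kernels and cokernels -/

variable {E F G : OMod.{u} A}

/-- A morphism is completely bounded below if its amplifications are bounded below, with a
constant that does not depend on the size of the matrices. These turn out to be the kernels. -/
def IsCompletelyBoundedBelow (f : E ⟶ F) : Prop :=
  ∃ c : ℝ≥0, ∀ (n : ℕ) (x : Matrix (Fin n) (Fin n) E), mnorm x ≤ c * mnorm (x.map (lin f))

namespace IsCompletelyBoundedBelow

theorem of_comp {f : E ⟶ F} {g : F ⟶ G} (hfg : IsCompletelyBoundedBelow (f ≫ g)) :
    IsCompletelyBoundedBelow f := by
  obtain ⟨c, hc⟩ := hfg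
  obtain ⟨d, hd⟩ := exists_mnorm_map_le g
  refine ⟨c * d, fun n x => (hc n x).trans ?_⟩
  rw [NNReal.coe_mul, mul_assoc, map_lin_comp]
  exact mul_le_mul_of_nonneg_left (hd n _) c.coe_nonneg

theorem comp {f : E ⟶ F} {g : F ⟶ G} (hf : IsCompletelyBoundedBelow f)
    (hg : IsCompletelyBoundedBelow g) : IsCompletelyBoundedBelow (f ≫ g) := by
  obtain ⟨c, hc⟩ := hf
  obtain ⟨d, hd⟩ := hg
  refine ⟨c * d, fun n x => (hc n x).trans ?_⟩
  rw [NNReal.coe_mul, mul_assoc, map_lin_comp]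
  exact mul_le_mul_of_nonneg_left (hd n _) c.coe_nonneg

protected theorem id (E : OMod.{u} A) : IsCompletelyBoundedBelow (𝟙 E) :=
  ⟨1, fun _ _ => (one_mul _).ge⟩

variable {f : E ⟶ F}

theorem exists_norm_le (hf : IsCompletelyBoundedBelow f) :
    ∃ c : ℝ≥0, ∀ x, ‖x‖ ≤ c * ‖lin f x‖ := by
  obtain ⟨c, hc⟩ := hf
  exact ⟨c, fun x => by simpa only [mnorm_one] using! hc 1 !![x]⟩

theorem injective (hf : IsCompletelyBoundedBelow f) : Function.Injective (lin f) := by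
  obtain ⟨c, hc⟩ := hf.exists_norm_le
  refine (injective_iff_map_eq_zero (lin f)).2 fun x hx => ?_
  simpa only [hx, norm_zero, mul_zero, norm_le_zero_iff] using hc x

theorem isClosed_range (hf : IsCompletelyBoundedBelow f) :
    IsClosed (LinearMap.range (lin f) : Set F) := by
  obtain ⟨c, hc⟩ := hf.exists_norm_le
  let φ : E →L[ℂ] F := ⟨lin f, continuous_lin f⟩
  rw [LinearMap.coe_range]
  exact (φ.antilipschitz_of_bound hc).isClosed_range φ.uniformContinuous

theorem exists_lift (hf : IsCompletelyBoundedBelow f) (g : G ⟶ F)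
    (hfg : LinearMap.range (lin g) ≤ LinearMap.range (lin f)) : ∃ k : G ⟶ E, k ≫ f = g := by
  have hinj := hf.injective
  obtain ⟨c, hc⟩ := hf
  obtain ⟨d, hd⟩ := exists_mnorm_map_le g
  let k : G →ₗ[ℂ] E := (LinearEquiv.ofInjective (lin f) hinj).symm ∘ₗ
    (lin g).codRestrict _ fun x => hfg ⟨x, rfl⟩
  have hk (x : G) : lin f (k x) = lin g x :=
    LinearEquiv.ofInjective_symm_apply (lin f) (h := hinj) _
  refine ⟨homMk k (fun x a => hinj ?_) ⟨c * d, fun n x => (hc n _).trans ?_⟩, hom_ext hk⟩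
  · rw [hk, lin_act, lin_act, hk]
  · have hkx : (x.map k).map (lin f) = x.map (lin g) := Matrix.ext fun _ _ => hk _
    rw [hkx, NNReal.coe_mul, mul_assoc]
    exact mul_le_mul_of_nonneg_left (hd n x) c.coe_nonneg

theorem mono (hf : IsCompletelyBoundedBelow f) : Mono f :=
  ⟨fun _ _ h => hom_ext fun x => hf.injective (LinearMap.congr_fun (congrArg lin h) x)⟩

end IsCompletelyBoundedBelow

theorem isCBIsoOntoClosedRange_iff {f : E ⟶ F} :
    IsCBIsoOntoClosedRange f ↔ IsCompletelyBoundedBelow f := by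
  constructor
  · rintro ⟨-, g, hgf, -, -, c, hc⟩
    refine ⟨c.toNNReal, fun n x => ?_⟩
    have hgfx : (x.map (lin f).rangeRestrict).map g = x := Matrix.ext fun _ _ => hgf _
    calc mnorm x = mnorm ((x.map (lin f).rangeRestrict).map g) := by rw [hgfx]
      _ ≤ c * mnorm (x.map (lin f)) := hc n _
      _ ≤ c.toNNReal * mnorm (x.map (lin f)) :=
        mul_le_mul_of_nonneg_right (Real.le_coe_toNNReal c) (mnorm_nonneg _)
  · intro hf
    have hinj := hf.injective
    refine ⟨hf.isClosed_range, ?_⟩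
    let e := LinearEquiv.ofInjective (lin f) hinj
    have he (y : LinearMap.range (lin f)) : lin f (e.symm y) = y :=
      LinearEquiv.ofInjective_symm_apply (lin f) (h := hinj) _
    obtain ⟨c, hc⟩ := hf
    refine ⟨e.symm, e.symm_apply_apply, e.apply_symm_apply, fun y z a hz => hinj ?_,
      c, fun n y => (hc n _).trans_eq ?_⟩
    · rw [LinearEquiv.coe_coe, he, lin_act, he, hz]
    · exact congrArg (c * mnorm ·) (Matrix.ext fun _ _ => he _)

theorem isCompletelyOpen_iff {f : E ⟶ F} : IsCompletelyOpen f ↔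
    ∃ c : ℝ≥0, ∀ (n : ℕ) (y : Matrix (Fin n) (Fin n) F),
      ∃ x : Matrix (Fin n) (Fin n) E, x.map (lin f) = y ∧ mnorm x ≤ c * mnorm y := by
  constructor
  · rintro ⟨γ, hγ, h⟩
    refine ⟨(2 / γ).toNNReal, fun n y => ?_⟩
    rw [Real.coe_toNNReal _ (by positivity)]
    rcases (mnorm_nonneg y).eq_or_lt with hy | hy
    · refine ⟨0, ?_, ?_⟩
      · rw [eq_zero_of_matNorm_eq_zero hy.symm, Matrix.map_zero _ (map_zero _)]
      · rw [← hy, mul_zero]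
        exact (map_zero (OperatorSpace.matNorm (E := E) n)).le
    set s : ℝ := γ / (2 * mnorm y) with hs
    have hs0 : 0 < s := by positivity
    have hnorm : ‖(s : ℂ)‖ = s := Complex.norm_of_nonneg hs0.le
    obtain ⟨x, hx, hxy⟩ := h n ((s : ℂ) • y) <| by
      rw [mnorm_smul, hnorm, hs]
      field_simp
      norm_num
    refine ⟨(s : ℂ)⁻¹ • x, ?_, ?_⟩
    · rw [Matrix.map_smul _ _ (map_smul _ _), hxy, inv_smul_smul₀ (mod_cast hs0.ne')]
    · rw [mnorm_smul, norm_inv, hnorm, hs, inv_div, mul_div_right_comm]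
      exact mul_le_of_le_one_right (by positivity) hx.le
  · rintro ⟨c, hc⟩
    refine ⟨(c + 1 : ℝ)⁻¹, by positivity, fun n y hy => ?_⟩
    obtain ⟨x, hxy, hx⟩ := hc n y
    refine ⟨x, hx.trans_lt ?_, hxy⟩
    calc (c : ℝ) * mnorm y ≤ (c + 1) * mnorm y :=
          mul_le_mul_of_nonneg_right (le_add_of_nonneg_right zero_le_one) (mnorm_nonneg y)
      _ < 1 := (lt_inv_mul_iff₀ (by positivity)).1 (by rwa [mul_one])

namespace IsCompletelyOpen

theorem of_comp {f : E ⟶ F} {g : F ⟶ G} (hfg : IsCompletelyOpen (f ≫ g)) : IsCompletelyOpen g := by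
  rw [isCompletelyOpen_iff] at hfg ⊢
  obtain ⟨c, hc⟩ := hfg
  obtain ⟨d, hd⟩ := exists_mnorm_map_le f
  refine ⟨d * c, fun n z => ?_⟩
  obtain ⟨x, hxz, hx⟩ := hc n z
  refine ⟨x.map (lin f), hxz, (hd n x).trans ?_⟩
  rw [NNReal.coe_mul, mul_assoc]
  exact mul_le_mul_of_nonneg_left hx d.coe_nonneg

theorem comp {f : E ⟶ F} {g : F ⟶ G} (hf : IsCompletelyOpen f) (hg : IsCompletelyOpen g) :
    IsCompletelyOpen (f ≫ g) := by
  rw [isCompletelyOpen_iff] at hf hg ⊢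
  obtain ⟨c, hc⟩ := hf
  obtain ⟨d, hd⟩ := hg
  refine ⟨c * d, fun n z => ?_⟩
  obtain ⟨y, rfl, hy⟩ := hd n z
  obtain ⟨x, rfl, hx⟩ := hc n y
  refine ⟨x, rfl, hx.trans ?_⟩
  rw [NNReal.coe_mul, mul_assoc]
  exact mul_le_mul_of_nonneg_left hy c.coe_nonneg

protected theorem id (E : OMod.{u} A) : IsCompletelyOpen (𝟙 E) :=
  ⟨1, one_pos, fun _ y hy => ⟨y, hy, rfl⟩⟩

variable {f : E ⟶ F}

theorem surjective (hf : IsCompletelyOpen f) : Function.Surjective (lin f) := by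
  obtain ⟨c, hc⟩ := isCompletelyOpen_iff.1 hf
  intro y
  obtain ⟨x, hxy, -⟩ := hc 1 !![y]
  exact ⟨x 0 0, congrFun₂ hxy 0 0⟩

theorem exists_desc (hf : IsCompletelyOpen f) (g : E ⟶ G)
    (hfg : LinearMap.ker (lin f) ≤ LinearMap.ker (lin g)) : ∃ k : F ⟶ G, f ≫ k = g := by
  have hsurj := hf.surjective
  obtain ⟨c, hc⟩ := isCompletelyOpen_iff.1 hf
  obtain ⟨d, hd⟩ := exists_mnorm_map_le g
  let k : F →ₗ[ℂ] G := (LinearMap.ker (lin f)).liftQ (lin g) hfg ∘ₗ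
    ((lin f).quotKerEquivOfSurjective hsurj).symm
  have hk (x : E) : k (lin f x) = lin g x := by
    have hx : ((lin f).quotKerEquivOfSurjective hsurj).symm (lin f x) = Submodule.Quotient.mk x :=
      (LinearEquiv.symm_apply_eq _).2 rfl
    exact congrArg ((LinearMap.ker (lin f)).liftQ (lin g) hfg) hx
  refine ⟨homMk k (fun y a => ?_) ⟨d * c, fun n y => ?_⟩, hom_ext hk⟩
  · obtain ⟨x, rfl⟩ := hsurj y
    rw [← lin_act, hk, hk, lin_act]
  · obtain ⟨x, rfl, hx⟩ := hc n y
    have hkx : (x.map (lin f)).map k = x.map (lin g) := Matrix.ext fun _ _ => hk _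
    rw [hkx, NNReal.coe_mul, mul_assoc]
    exact (hd n x).trans (mul_le_mul_of_nonneg_left hx d.coe_nonneg)

theorem epi (hf : IsCompletelyOpen f) : Epi f :=
  ⟨fun _ _ h => hom_ext <| hf.surjective.forall.2 fun x => LinearMap.congr_fun (congrArg lin h) x⟩

end IsCompletelyOpen

theorem IsCompletelyBoundedBelow.nonempty_isLimit {f : E ⟶ F} (hf : IsCompletelyBoundedBelow f)
    {g : F ⟶ G} (w : f ≫ g = 0) (hker : LinearMap.ker (lin g) ≤ LinearMap.range (lin f)) :
    Nonempty (IsLimit (KernelFork.ofι f w)) := by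
  have := hf.mono
  have hlift {M : OMod.{u} A} (k : M ⟶ F) (hk : k ≫ g = 0) : ∃ l : M ⟶ E, l ≫ f = k :=
    hf.exists_lift k ((comp_eq_zero_iff.1 hk).trans hker)
  exact ⟨KernelFork.IsLimit.ofι' f w fun k hk => ⟨(hlift k hk).choose, (hlift k hk).choose_spec⟩⟩

theorem IsCompletelyOpen.nonempty_isColimit {g : F ⟶ G} (hg : IsCompletelyOpen g)
    {f : E ⟶ F} (w : f ≫ g = 0)
    (hker : LinearMap.ker (lin g) ≤ (LinearMap.range (lin f)).topologicalClosure) :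
    Nonempty (IsColimit (CokernelCofork.ofπ g w)) := by
  have := hg.epi
  have hdesc {M : OMod.{u} A} (k : F ⟶ M) (hk : f ≫ k = 0) : ∃ l : G ⟶ M, g ≫ l = k :=
    hg.exists_desc k <| hker.trans <|
      Submodule.topologicalClosure_minimal _ (comp_eq_zero_iff.1 hk) (isClosed_ker k)
  exact ⟨CokernelCofork.IsColimit.ofπ' g w fun k hk =>
    ⟨(hdesc k hk).choose, (hdesc k hk).choose_spec⟩⟩

section Kernel

variable [HasBoundedRightApproximateUnit A]

/-- The kernel of a morphism, as a closed submodule of its source. -/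
noncomputable def kernelObj (g : F ⟶ G) : OMod.{u} A :=
  ofSubmodule F (LinearMap.ker (lin g)) (isClosed_ker g) fun x hx a => by
    rw [LinearMap.mem_ker] at hx ⊢
    rw [lin_act, hx, LinearMap.map_zero₂]

/-- The inclusion of the kernel of a morphism. -/
noncomputable def kernelι (g : F ⟶ G) : kernelObj g ⟶ F :=
  submoduleι F _ _ _

theorem range_lin_kernelι (g : F ⟶ G) :
    LinearMap.range (lin (kernelι g)) = LinearMap.ker (lin g) :=
  range_lin_submoduleι ..

theorem isCompletelyBoundedBelow_kernelι (g : F ⟶ G) : IsCompletelyBoundedBelow (kernelι g) :=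
  ⟨1, fun _ _ => (one_mul _).ge⟩

theorem kernelι_comp (g : F ⟶ G) : kernelι g ≫ g = 0 :=
  comp_eq_zero_iff.2 (range_lin_kernelι g).le

instance : HasKernels (OMod.{u} A) where
  has_limit g :=
    have ⟨h⟩ := (isCompletelyBoundedBelow_kernelι g).nonempty_isLimit (kernelι_comp g)
      (range_lin_kernelι g).ge
    ⟨⟨_, h⟩⟩

theorem nonempty_isLimit_iff {f : E ⟶ F} {g : F ⟶ G} (w : f ≫ g = 0) :
    Nonempty (IsLimit (KernelFork.ofι f w)) ↔
      IsCompletelyBoundedBelow f ∧ LinearMap.ker (lin g) ≤ LinearMap.range (lin f) := by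
  refine ⟨fun ⟨hf⟩ => ?_, fun h => h.1.nonempty_isLimit w h.2⟩
  obtain ⟨k, hk⟩ := KernelFork.IsLimit.lift' hf (kernelι g) (kernelι_comp g)
  obtain ⟨l, hl⟩ := (isCompletelyBoundedBelow_kernelι g).exists_lift f
    ((comp_eq_zero_iff.1 w).trans (range_lin_kernelι g).ge)
  have hlk : l ≫ k = 𝟙 E := Fork.IsLimit.hom_ext hf <| by
    rw [Fork.ι_ofι] at hk ⊢
    rw [Category.assoc, hk, hl, Category.id_comp]
  constructor
  · rw [← hl]
    exact (IsCompletelyBoundedBelow.of_comp (g := k) (hlk ▸ .id E)).comp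
      (isCompletelyBoundedBelow_kernelι g)
  · rw [← range_lin_kernelι g]
    rintro _ ⟨x, rfl⟩
    exact ⟨lin k x, LinearMap.congr_fun (congrArg lin hk) x⟩

end Kernel

section Cokernel

/-- The cokernel of a morphism, as the quotient of its target by the closure of the range. -/
noncomputable def cokernelObj (f : E ⟶ F) : OMod.{u} A :=
  quotient F (LinearMap.range (lin f)).topologicalClosure
    (Submodule.isClosed_topologicalClosure _) fun x hx a => by
      refine map_mem_closure (f := fun x => F.act x a) (F.continuous_act_left a) hx ?_
      rintro _ ⟨y, rfl⟩
      exact ⟨E.act y a, lin_act f y a⟩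

/-- The projection to the cokernel of a morphism. -/
noncomputable def cokernelπ (f : E ⟶ F) : F ⟶ cokernelObj f :=
  quotientπ F _ _ _

theorem ker_lin_cokernelπ (f : E ⟶ F) :
    LinearMap.ker (lin (cokernelπ f)) = (LinearMap.range (lin f)).topologicalClosure :=
  ker_lin_quotientπ ..

theorem isCompletelyOpen_cokernelπ (f : E ⟶ F) : IsCompletelyOpen (cokernelπ f) := by
  refine ⟨1, one_pos, fun n y hy => ?_⟩
  obtain ⟨x, hxy, hx⟩ := exists_matNorm_lt_of_quotientMatNorm_lt _ hy
  exact ⟨x, hx, hxy⟩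

theorem comp_cokernelπ (f : E ⟶ F) : f ≫ cokernelπ f = 0 :=
  comp_eq_zero_iff.2 <| (Submodule.le_topologicalClosure _).trans (ker_lin_cokernelπ f).ge

instance : HasCokernels (OMod.{u} A) where
  has_colimit f :=
    have ⟨h⟩ := (isCompletelyOpen_cokernelπ f).nonempty_isColimit (comp_cokernelπ f)
      (ker_lin_cokernelπ f).le
    ⟨⟨_, h⟩⟩

theorem nonempty_isColimit_iff {f : E ⟶ F} {g : F ⟶ G} (w : f ≫ g = 0) :
    Nonempty (IsColimit (CokernelCofork.ofπ g w)) ↔ IsCompletelyOpen g ∧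
      LinearMap.ker (lin g) ≤ (LinearMap.range (lin f)).topologicalClosure := by
  refine ⟨fun ⟨hg⟩ => ?_, fun h => h.1.nonempty_isColimit w h.2⟩
  obtain ⟨k, hk⟩ := CokernelCofork.IsColimit.desc' hg (cokernelπ f) (comp_cokernelπ f)
  obtain ⟨l, hl⟩ := (isCompletelyOpen_cokernelπ f).exists_desc g <|
    (ker_lin_cokernelπ f).le.trans <| Submodule.topologicalClosure_minimal _
      (comp_eq_zero_iff.1 w) (isClosed_ker g)
  have hkl : k ≫ l = 𝟙 G := Cofork.IsColimit.hom_ext hg <| by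
    rw [Cofork.π_ofπ] at hk ⊢
    rw [reassoc_of% hk, hl]
    exact (Category.comp_id g).symm
  constructor
  · rw [← hl]
    exact (isCompletelyOpen_cokernelπ f).comp (.of_comp (f := k) (hkl ▸ .id G))
  · intro x hx
    rw [← ker_lin_cokernelπ f, LinearMap.mem_ker, ← hk]
    exact (congrArg (lin k) hx).trans (map_zero _)

end Cokernel

/-! ### Pullbacks and pushouts -/

open ExactCat

variable {L : OMod.{u} A}

theorem isKernelMap_iff [HasBoundedRightApproximateUnit A] {f : E ⟶ F} :
    IsKernelMap f ↔ IsCompletelyBoundedBelow f := by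
  constructor
  · rintro ⟨_, _, w, hf⟩
    exact ((nonempty_isLimit_iff w).1 hf).1
  · intro hf
    refine ⟨_, cokernelπ f, comp_cokernelπ f, hf.nonempty_isLimit _ ?_⟩
    rw [ker_lin_cokernelπ, hf.isClosed_range.submodule_topologicalClosure_eq]

theorem isCokernelMap_iff [HasBoundedRightApproximateUnit A] {g : F ⟶ G} :
    IsCokernelMap g ↔ IsCompletelyOpen g := by
  constructor
  · rintro ⟨_, _, w, hg⟩
    exact ((nonempty_isColimit_iff w).1 hg).1
  · intro hg
    refine ⟨_, kernelι g, kernelι_comp g, hg.nonempty_isColimit _ ?_⟩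
    rw [range_lin_kernelι]
    exact Submodule.le_topologicalClosure _

instance [HasBoundedRightApproximateUnit A] : HasPullbacks (OMod.{u} A) :=
  have : HasEqualizers (OMod.{u} A) := Preadditive.hasEqualizers_of_hasKernels
  hasPullbacks_of_hasBinaryProducts_of_hasEqualizers _

instance : HasPushouts (OMod.{u} A) :=
  have : HasCoequalizers (OMod.{u} A) := Preadditive.hasCoequalizers_of_hasCokernels
  hasPushouts_of_hasBinaryCoproducts_of_hasCoequalizers _

theorem exists_map_eq_of_isPullback [HasBoundedRightApproximateUnit A]
    {p : L ⟶ E} {q : L ⟶ F} {f : E ⟶ G} {g : F ⟶ G} (hpq : IsPullback p q f g) :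
    ∃ c : ℝ≥0, ∀ (n : ℕ) (x : Matrix (Fin n) (Fin n) E) (y : Matrix (Fin n) (Fin n) F),
      x.map (lin f) = y.map (lin g) → ∃ t : Matrix (Fin n) (Fin n) L,
        t.map (lin p) = x ∧ t.map (lin q) = y ∧ mnorm t ≤ c * max (mnorm x) (mnorm y) := by
  let D : prod E F ⟶ G := prodFst E F ≫ f - prodSnd E F ≫ g
  obtain ⟨l, hlp, hlq⟩ := hpq.exists_lift (kernelι D ≫ prodFst E F) (kernelι D ≫ prodSnd E F) <| by
    simpa only [D, Preadditive.comp_sub, sub_eq_zero, Category.assoc] using kernelι_comp D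
  obtain ⟨c, hc⟩ := exists_mnorm_map_le l
  refine ⟨c, fun n x y hxy => ?_⟩
  obtain ⟨t, ht⟩ : ∃ t : Matrix (Fin n) (Fin n) (kernelObj D),
      t.map (lin (kernelι D)) = Matrix.of fun i j => (x i j, y i j) :=
    exists_map_eq fun i j => (range_lin_kernelι D).ge (sub_eq_zero.2 (congrFun₂ hxy i j))
  refine ⟨t.map (lin l), ?_, ?_, (hc n t).trans_eq ?_⟩
  · rw [← map_lin_comp, hlp, map_lin_comp, ht]
    rfl
  · rw [← map_lin_comp, hlq, map_lin_comp, ht]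
    rfl
  · exact congrArg (c * mnorm (E := prod E F) ·) ht

theorem IsCompletelyOpen.of_isPullback [HasBoundedRightApproximateUnit A]
    {p : L ⟶ E} {q : L ⟶ F} {f : E ⟶ G} {g : F ⟶ G} (hpq : IsPullback p q f g)
    (hf : IsCompletelyOpen f) : IsCompletelyOpen q := by
  obtain ⟨b, hb⟩ := exists_map_eq_of_isPullback hpq
  obtain ⟨c, hc⟩ := isCompletelyOpen_iff.1 hf
  obtain ⟨d, hd⟩ := exists_mnorm_map_le g
  refine isCompletelyOpen_iff.2 ⟨b * max (c * d) 1, fun n y => ?_⟩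
  obtain ⟨x, hxy, hx⟩ := hc n (y.map (lin g))
  obtain ⟨t, -, hty, ht⟩ := hb n x y hxy
  refine ⟨t, hty, ht.trans ?_⟩
  have hxd : mnorm x ≤ c * d * mnorm y := by
    rw [mul_assoc]
    exact hx.trans (mul_le_mul_of_nonneg_left (hd n y) c.coe_nonneg)
  calc b * max (mnorm x) (mnorm y) ≤ b * max (c * d * mnorm y) (1 * mnorm y) := by
        rw [one_mul]
        gcongr
    _ = ↑(b * max (c * d) 1) * mnorm y := by
        rw [← max_mul_of_nonneg _ _ (mnorm_nonneg y)]
        push_cast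
        ring

theorem IsCompletelyBoundedBelow.prodLift_zero_id_comp_cokernelπ {f : G ⟶ E}
    (hf : IsCompletelyBoundedBelow f) (g : G ⟶ F) :
    IsCompletelyBoundedBelow (prodLift 0 (𝟙 F) ≫ cokernelπ (prodLift f (-g))) := by
  let D : G ⟶ prod E F := prodLift f (-g)
  let q : F ⟶ cokernelObj D := prodLift 0 (𝟙 F) ≫ cokernelπ D
  have hD : IsCompletelyBoundedBelow D := .of_comp (g := prodFst E F) hf
  obtain ⟨c, hc⟩ := isCompletelyOpen_iff.1 (isCompletelyOpen_cokernelπ D)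
  obtain ⟨d, hd⟩ := hf
  obtain ⟨b, hb⟩ := exists_mnorm_map_le g
  refine ⟨(1 + b * d) * c, fun n y => ?_⟩
  obtain ⟨z, hzy, hz⟩ := hc n (y.map (lin q))
  have hker (i j : Fin n) : z i j - lin (prodLift 0 (𝟙 F)) (y i j) ∈ LinearMap.range (lin D) := by
    rw [← hD.isClosed_range.submodule_topologicalClosure_eq, ← ker_lin_cokernelπ,
      LinearMap.mem_ker, map_sub, sub_eq_zero]
    exact congrFun₂ hzy i j
  choose w hw using hker
  have hwf : (Matrix.of w).map (lin f) = z.map (lin (prodFst E F)) := Matrix.ext fun i j =>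
    (congrArg Prod.fst (hw i j)).trans (sub_zero _)
  have hy : y = z.map (lin (prodSnd E F)) + (Matrix.of w).map (lin g) := Matrix.ext fun i j => by
    have hwg : -lin g (w i j) = lin (prodSnd E F) (z i j) - y i j := congrArg Prod.snd (hw i j)
    exact (eq_add_of_sub_eq' ((neg_eq_iff_eq_neg.1 hwg).trans (neg_sub _ _)).symm)
  calc mnorm y ≤ mnorm (z.map (lin (prodSnd E F))) + mnorm ((Matrix.of w).map (lin g)) :=
        (congrArg mnorm hy).trans_le (mnorm_add_le _ _)
    _ ≤ mnorm (z.map (lin (prodSnd E F))) + b * (d * mnorm (z.map (lin (prodFst E F)))) := by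
        grw [hb, hd, hwf]
    _ ≤ mnorm z + b * (d * mnorm z) := by
        gcongr
        · exact le_max_right _ _
        · exact le_max_left _ _
    _ = (1 + b * d) * mnorm z := by ring
    _ ≤ (1 + b * d) * (c * mnorm (y.map (lin q))) := by gcongr
    _ = ↑((1 + b * d) * c) * mnorm (y.map (lin q)) := by
        push_cast
        ring

theorem IsCompletelyBoundedBelow.of_isPushout {f : G ⟶ E} {g : G ⟶ F} {p : E ⟶ L} {q : F ⟶ L}
    (hpq : IsPushout f g p q) (hf : IsCompletelyBoundedBelow f) : IsCompletelyBoundedBelow q := by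
  let D : G ⟶ prod E F := prodLift f (-g)
  have hD : f ≫ prodLift (𝟙 E) 0 - g ≫ prodLift 0 (𝟙 F) = D := hom_ext fun x =>
    Prod.ext (sub_zero (lin f x)) (zero_sub (lin g x))
  obtain ⟨l, -, hl⟩ := hpq.exists_desc (prodLift (𝟙 E) 0 ≫ cokernelπ D)
    (prodLift 0 (𝟙 F) ≫ cokernelπ D) <| by
      rw [← sub_eq_zero, ← Category.assoc, ← Category.assoc, ← Preadditive.sub_comp, hD,
        comp_cokernelπ]
  exact .of_comp (g := l) (hl ▸ hf.prodLift_zero_id_comp_cokernelπ g)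

theorem isQuasiAbelian [HasBoundedRightApproximateUnit A] : IsQuasiAbelian (OMod.{u} A) where
  isAdditive := isAdditive
  hasKernels := inferInstance
  hasCokernels := inferInstance
  e2 f g hf := ⟨inferInstance, fun h k hP => by
    rw [admissibleMono_iff_isKernelMap, isKernelMap_iff] at hf ⊢
    exact hf.of_isPushout hP⟩
  e2op f g hf := ⟨inferInstance, fun h k hP => by
    rw [admissibleEpi_iff_isCokernelMap, isCokernelMap_iff] at hf ⊢
    exact hf.of_isPullback hP⟩

end OMod

open ExactCat OMod in
theorem mainTheorem3_general {H : Type v} [NormedAddCommGroup H] [InnerProductSpace ℂ H]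
    (A : NonUnitalSubalgebra ℂ (H →L[ℂ] H)) [HasBoundedRightApproximateUnit A] :
    (IsAdditive (OMod.{u} A) ∧
      IsExactStructure (KernelCokernelPair : ShortComplex (OMod.{u} A) → Prop)) ∧
    IsQuasiAbelian (OMod.{u} A) ∧
    (∀ {E F : OMod.{u} A} (f : E ⟶ F), IsKernelMap f ↔ IsCBIsoOntoClosedRange f) ∧
    (∀ {E F : OMod.{u} A} (f : E ⟶ F), IsCokernelMap f ↔ IsCompletelyOpen f) ∧
    (HasPullbacks (OMod.{u} A) ∧
      ∀ {E F G L : OMod.{u} A} (p : L ⟶ E) (q : L ⟶ F) (f : E ⟶ G) (g : F ⟶ G),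
        IsPullback p q f g → IsCokernelMap f → IsCokernelMap q) ∧
    (HasPushouts (OMod.{u} A) ∧
      ∀ {E F G L : OMod.{u} A} (f : G ⟶ E) (g : G ⟶ F) (p : E ⟶ L) (q : F ⟶ L),
        IsPushout f g p q → IsKernelMap f → IsKernelMap q) :=
  ⟨⟨isAdditive, isQuasiAbelian.isExactStructure⟩, isQuasiAbelian,
    fun _ => isKernelMap_iff.trans isCBIsoOntoClosedRange_iff.symm,
    fun _ => isCokernelMap_iff,
    ⟨inferInstance, fun _ _ _ _ hpq hf =>
      isCokernelMap_iff.2 ((isCokernelMap_iff.1 hf).of_isPullback hpq)⟩,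
    ⟨inferInstance, fun _ _ _ _ hpq hf =>
      isKernelMap_iff.2 ((isKernelMap_iff.1 hf).of_isPushout hpq)⟩⟩

open ExactCat OMod in
theorem mainTheorem3 {H : Type v} [NormedAddCommGroup H] [InnerProductSpace ℂ H] [CompleteSpace H]
    (A : NonUnitalSubalgebra ℂ (H →L[ℂ] H)) (hA : IsOperatorAlgebra A) :
    -- `OMod A` is additive and the class of all kernel-cokernel pairs is an exact structure on it
    (IsAdditive (OMod.{u} A) ∧
      IsExactStructure (KernelCokernelPair : ShortComplex (OMod.{u} A) → Prop)) ∧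
    -- `OMod A` is quasi-abelian
    IsQuasiAbelian (OMod.{u} A) ∧
    -- description of kernels and cokernels
    (∀ {E F : OMod.{u} A} (f : E ⟶ F), IsKernelMap f ↔ IsCBIsoOntoClosedRange f) ∧
    (∀ {E F : OMod.{u} A} (f : E ⟶ F), IsCokernelMap f ↔ IsCompletelyOpen f) ∧
    -- pullbacks exist and preserve cokernels
    (HasPullbacks (OMod.{u} A) ∧
      ∀ {E F G L : OMod.{u} A} (p : L ⟶ E) (q : L ⟶ F) (f : E ⟶ G) (g : F ⟶ G),
        IsPullback p q f g → IsCokernelMap f → IsCokernelMap q) ∧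
    -- pushouts exist and preserve kernels
    (HasPushouts (OMod.{u} A) ∧
      ∀ {E F G L : OMod.{u} A} (f : G ⟶ E) (g : G ⟶ F) (p : E ⟶ L) (q : F ⟶ L),
        IsPushout f g p q → IsKernelMap f → IsKernelMap q) :=
  have := hA.hasBoundedRightApproximateUnit
  mainTheorem3_general A
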